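/- Let $l,m\ge 1$ be integers, let $\Delta_{k-1}\subset\mathbb{R}^k$ denote the probability simplex, and set $N=m^{l+1}-1$. The mixture transition distribution model $\mathrm{MTD}_{l,m}\subset\Delta_N$ is the set of all points $p=(p_{i_0i_1\cdots i_l})$, indexed by the sequences in $\{1,\dots,m\}^{l+1}$, of the form $$p_{i_0 i_1\cdots i_l}=\frac{1}{m^l}\sum_{j=1}^{l}\lambda_j\,q_{i_{j-1},i_l},$$ where $q=(q_{rs})$ is an $m\times m$ matrix whose rows lie in $\Delta_{m-1}$ and $\lambda\in\Delta_{l-1}$. Let $X=\overline{\mathrm{MTD}}_{l,m}$ be its Zariski closure in the complex projective space $\mathbb{P}^N$. Then $X$ is a cone with base $\mathbb{P}^{m-1}$ over the Segre variety $\mathbb{P}^{l-1}\times\mathbb{P}^{m^2-2m}$. That is, $\mathbb{P}^N$ contains disjoint linear subspaces $B\cong\mathbb{P}^{m-1}$ and $L\cong\mathbb{P}^{l(m-1)^2-1}$ such that $X$ is the union of $B$ and of all linear spaces spanned by $B$ and a point of $Y$, where $Y\subset L$ is the image, under an isomorphism of $L$ with the projective space of nonzero $l\times(m-1)^2$ matrices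 up to scaling, of the variety of rank one matrices (for $m=1$ this is read as $L=Y=\emptyset$ and $X=B$). If $l\ge 2$ and $m\ge 3$, then $X$ is singular and, for this same $B$, the singular locus of $X$ is exactly $B$. If $m\ge 2$, then the degree of $X$ equals $\binom{l+(m-1)^2-2}{l-1}$. -/

import Mathlib

open scoped LinearAlgebra.Projectivization

noncomputable section

namespace ProjGeom

variable {σ : Type*} [Fintype σ]

/-- The Zariski closure of a subset `S` of the complex projective space with homogeneous
coordinates indexed by `σ`: the common zero set of all homogeneous polynomials that vanish on `S`.
(The vanishing of a homogeneous polynomial at a point does not depend on the chosen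
representative.) -/
def zariskiClosure (S : Set (ℙ ℂ (σ → ℂ))) : Set (ℙ ℂ (σ → ℂ)) :=
  {p | ∀ (n : ℕ) (F : MvPolynomial σ ℂ), F.IsHomogeneous n →
    (∀ s ∈ S, MvPolynomial.eval s.rep F = 0) → MvPolynomial.eval p.rep F = 0}

/-- The degree `n` part of the homogeneous vanishing ideal of `X`. -/
def vanishingForms (X : Set (ℙ ℂ (σ → ℂ))) (n : ℕ) :
    Submodule ℂ (MvPolynomial.homogeneousSubmodule σ ℂ n) where
  carrier := {F | ∀ p ∈ X, MvPolynomial.eval p.rep (F : MvPolynomial σ ℂ) = 0}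
  add_mem' := by
    intro F G hF hG p hp
    simp [hF p hp, hG p hp]
  zero_mem' := by
    intro p _
    simp
  smul_mem' := by
    intro c F hF p hp
    simp [hF p hp]

/-- The Hilbert function of `X`: the dimension of the degree `n` part of the homogeneous
coordinate ring of `X`. -/
def hilbertFunction (X : Set (ℙ ℂ (σ → ℂ))) (n : ℕ) : ℕ :=
  Module.finrank ℂ (MvPolynomial.homogeneousSubmodule σ ℂ n ⧸ vanishingForms X n)

/-- `X` has degree `d`: the Hilbert function of `X` agrees for large arguments with a polynomial
(the Hilbert polynomial), and `d` is the leading coefficient of this polynomial multiplied by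
the factorial of its degree. -/
def HasDegree (X : Set (ℙ ℂ (σ → ℂ))) (d : ℕ) : Prop :=
  ∃ P : Polynomial ℚ,
    (∀ᶠ n : ℕ in Filter.atTop, (hilbertFunction X n : ℚ) = P.eval (n : ℚ)) ∧
    P.leadingCoeff * (P.natDegree.factorial : ℚ) = d

/-- The coordinate ring of a set `Z` of points of affine space. -/
abbrev CoordRing (Z : Set (σ → ℂ)) : Type _ :=
  MvPolynomial σ ℂ ⧸ MvPolynomial.vanishingIdeal ℂ Z

/-- Evaluation of regular functions on `Z` at a point `a` of `Z`. -/
def evalAt (Z : Set (σ → ℂ)) (a : σ → ℂ) (ha : a ∈ Z) : CoordRing Z →ₐ[ℂ] ℂ :=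
  Ideal.Quotient.liftₐ (MvPolynomial.vanishingIdeal ℂ Z) (MvPolynomial.aeval a)
    (fun _ hF => hF a ha)

instance evalAt_ker_isPrime (Z : Set (σ → ℂ)) (a : σ → ℂ) (ha : a ∈ Z) :
    (RingHom.ker (evalAt Z a ha)).IsPrime :=
  RingHom.ker_isPrime (evalAt Z a ha)

/-- The affine algebraic set `Z` is smooth over `ℂ` at its point `a`. -/
def SmoothAt (Z : Set (σ → ℂ)) (a : σ → ℂ) (ha : a ∈ Z) : Prop :=
  Algebra.IsSmoothAt ℂ (RingHom.ker (evalAt Z a ha))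

/-- The part of `X` in the standard affine chart where the `i`-th homogeneous coordinate does not
vanish, as a subset of the affine hyperplane of vectors with `i`-th coordinate `1`. -/
def chart (X : Set (ℙ ℂ (σ → ℂ))) (i : σ) : Set (σ → ℂ) :=
  {a | a i = 1 ∧ ∃ h : a ≠ 0, Projectivization.mk ℂ a h ∈ X}

/-- The singular locus of the projective algebraic set `X`: the points of `X` at which `X` is not
smooth, where smoothness is tested in the standard affine charts. -/
def singularLocus (X : Set (ℙ ℂ (σ → ℂ))) : Set (ℙ ℂ (σ → ℂ)) :=
  {p | p ∈ X ∧ ¬ ∃ (i : σ) (a : σ → ℂ) (ha : a ∈ chart X i) (h : a ≠ 0),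
    p = Projectivization.mk ℂ a h ∧ SmoothAt (chart X i) a ha}

/-- The Segre variety of all rank one matrices of format `ι × κ`, up to scaling: the image of the
Segre embedding of `ℙ(ℂ^ι) × ℙ(ℂ^κ)` in `ℙ(ℂ^(ι × κ))`. -/
def segreVariety (ι κ : Type*) : Set (ℙ ℂ (ι × κ → ℂ)) :=
  {p | ∃ (a : ι → ℂ) (b : κ → ℂ) (h : (fun x : ι × κ => a x.1 * b x.2) ≠ 0),
    p = Projectivization.mk ℂ (fun x : ι × κ => a x.1 * b x.2) h}

/-- The cone over `Y` with base (vertex) the projective subspace `ℙ(U)`: the union of `ℙ(U)` and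
the projective subspaces spanned by `ℙ(U)` and a point of `Y`. -/
def coneOver {V : Type*} [AddCommGroup V] [Module ℂ V] (U : Submodule ℂ V) (Y : Set (ℙ ℂ V)) :
    Set (ℙ ℂ V) :=
  (U.projectivization : Set (ℙ ℂ V)) ∪
    ⋃ y ∈ Y, ((U ⊔ y.submodule).projectivization : Set (ℙ ℂ V))

end ProjGeom

namespace MTD

/-- The parametrization of the mixture transition distribution model, for a transition matrix `q`
and a mixing distribution `lam`. States are sequences `i 0, …, i l` over `Fin m`. -/
def param (l m : ℕ) (q : Fin m → Fin m → ℝ) (lam : Fin l → ℝ) : (Fin (l + 1) → Fin m) → ℝ :=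
  fun i => 1 / (m : ℝ) ^ l * ∑ j : Fin l, lam j * q (i j.castSucc) (i (Fin.last l))

/-- The mixture transition distribution model, the image of `param` on the product of `m` simplices
(the rows of the transition matrix) and one simplex (the mixing distribution). -/
def model (l m : ℕ) : Set ((Fin (l + 1) → Fin m) → ℝ) :=
  {x | ∃ (q : Fin m → Fin m → ℝ) (lam : Fin l → ℝ),
    (∀ r, q r ∈ stdSimplex ℝ (Fin m)) ∧ lam ∈ stdSimplex ℝ (Fin l) ∧ x = param l m q lam}

/-- The points of complex projective space given by the probability distributions in the model. -/
def projModel (l m : ℕ) : Set (ℙ ℂ ((Fin (l + 1) → Fin m) → ℂ)) :=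
  {p | ∃ x ∈ model l m, ∃ h : (fun i => (x i : ℂ)) ≠ 0,
    p = Projectivization.mk ℂ (fun i => (x i : ℂ)) h}

/-- The Zariski closure of the model in complex projective space of dimension `m ^ (l + 1) - 1`. -/
def projVariety (l m : ℕ) : Set (ℙ ℂ ((Fin (l + 1) → Fin m) → ℂ)) :=
  ProjGeom.zariskiClosure (projModel l m)

end MTD

end

/-! Subtract the first row from the transition matrix: `q r s = q 0 s + z r s`, where `z` has zero
first row and zero row sums, hence `(m-1)^2` free entries. Since the `λ j` sum to one, a model point
is, up to the factor `1/m^l`, a function of the last state alone plus a fixed injective linear image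
of the rank one matrix `λ ⊗ z`. So the model lies in the cone of all `base u + seg (a ⊗ b)`. The
normalisations of `q` and `λ` are lost on rescaling, so the model contains the images of a box of
real parameters `(u, a, b)`. Such a box is Zariski dense, and the cone is cut out by linear forms
and `2 × 2` minors, so the closure is the cone (`projVariety_eq_projCone`).

The rest holds for any such cone (`ConeData`). Where a matrix entry is nonzero, its row and column
determine the rank one matrix, so the chart is locally an open part of an affine space
(`smoothAt_of_segInv_ne_zero`). At a base point, the directions of two lines in the cone add up to a
tangent vector along which some minor is nonzero to second order. Smoothness would lift this vector
to `ℂ[x]/(x^3)`, where the minor gives `x^2 = 0` (`not_smoothAt_of_lines`).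

For the degree, the parametrization identifies forms of degree `n` on the cone with polynomials of
bidegree `(n, n)` in `(u, a, b)`, where `u` has bidegree `(1, 1)`
(`map_pullback_homogeneousSubmodule`). Counting monomials gives the Hilbert function as a
convolution of multichoose numbers, whose leading coefficient is read off in `hasDegree_projCone`.
-/

open scoped LinearAlgebra.Projectivization

noncomputable section

/-! ### Cones over Segre varieties in adapted linear coordinates. -/

namespace SegreCone

variable {σ μ ι κ : Type*}

/-- The rank one matrix `a bᵀ`. -/
def outer (a : ι → ℂ) (b : κ → ℂ) : ι × κ → ℂ := fun x => a x.1 * b x.2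

theorem smul_outer (c : ℂ) (a : ι → ℂ) (b : κ → ℂ) : c • outer a b = outer (c • a) b := by
  ext x
  simp [outer, mul_assoc]

/-- A matrix all of whose `2 × 2` minors vanish is an outer product. -/
theorem exists_eq_outer {M : ι × κ → ℂ}
    (h : ∀ j j' k k', M (j, k) * M (j', k') - M (j, k') * M (j', k) = 0) :
    ∃ a b, M = outer a b := by
  by_cases h0 : M = 0
  · exact ⟨0, 0, by rw [h0]; ext x; simp [outer]⟩
  · obtain ⟨⟨j, k⟩, hjk⟩ := Function.ne_iff.mp h0
    have hjk' : M (j, k) ≠ 0 := hjk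
    -- The column through a nonzero entry, normalised by that entry, times the row through it.
    refine ⟨fun j' => M (j', k) / M (j, k), fun k' => M (j, k'), ?_⟩
    ext ⟨j', k'⟩
    have := h j j' k k'
    simp only [outer]
    field_simp
    linear_combination this

/-- Linear coordinates on a projective space adapted to a cone with base `ℙ(ℂ^μ)` over the Segre
variety of rank one matrices of format `ι × κ`. The base is embedded by pulling back along `last`,
so that its image is spanned by vectors with entries `0` and `1`. -/
structure ConeData (σ μ ι κ : Type*) where
  last : σ → μ
  seg : (ι × κ → ℂ) →ₗ[ℂ] (σ → ℂ)
  baseInv : (σ → ℂ) →ₗ[ℂ] (μ → ℂ)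
  segInv : (σ → ℂ) →ₗ[ℂ] (ι × κ → ℂ)
  baseInv_base : ∀ u : μ → ℂ, baseInv (fun i => u (last i)) = u
  baseInv_seg : ∀ M, baseInv (seg M) = 0
  segInv_base : ∀ u : μ → ℂ, segInv (fun i => u (last i)) = 0
  segInv_seg : ∀ M, segInv (seg M) = M

namespace ConeData

variable (D : ConeData σ μ ι κ)

/-- The embedding of the base. -/
def base : (μ → ℂ) →ₗ[ℂ] (σ → ℂ) := LinearMap.funLeft ℂ ℂ D.last

@[simp] theorem base_apply (u : μ → ℂ) (i : σ) : D.base u i = u (D.last i) := rfl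

@[simp] theorem baseInv_base' (u : μ → ℂ) : D.baseInv (D.base u) = u := D.baseInv_base u
@[simp] theorem segInv_base' (u : μ → ℂ) : D.segInv (D.base u) = 0 := D.segInv_base u

attribute [simp] baseInv_seg segInv_seg

theorem base_injective : Function.Injective D.base :=
  Function.LeftInverse.injective D.baseInv_base'

theorem seg_injective : Function.Injective D.seg :=
  Function.LeftInverse.injective D.segInv_seg

/-- The parametrization of the affine cone. -/
def point (u : μ → ℂ) (a : ι → ℂ) (b : κ → ℂ) : σ → ℂ := D.base u + D.seg (outer a b)

@[simp] theorem baseInv_point (u : μ → ℂ) (a : ι → ℂ) (b : κ → ℂ) :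
    D.baseInv (D.point u a b) = u := by simp [point]

@[simp] theorem segInv_point (u : μ → ℂ) (a : ι → ℂ) (b : κ → ℂ) :
    D.segInv (D.point u a b) = outer a b := by simp [point]

theorem smul_point (c : ℂ) (u : μ → ℂ) (a : ι → ℂ) (b : κ → ℂ) :
    c • D.point u a b = D.point (c • u) (c • a) b := by
  simp [point, smul_add, ← smul_outer]

/-- The affine cone over the projective cone. -/
def affineCone : Set (σ → ℂ) := {v | ∃ u a b, v = D.point u a b}

theorem point_mem (u : μ → ℂ) (a : ι → ℂ) (b : κ → ℂ) : D.point u a b ∈ D.affineCone :=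
  ⟨u, a, b, rfl⟩

theorem base_mem (u : μ → ℂ) : D.base u ∈ D.affineCone := by
  refine ⟨u, 0, 0, ?_⟩
  have : outer (0 : ι → ℂ) (0 : κ → ℂ) = 0 := by ext; simp [outer]
  simp [point, this]

theorem smul_mem {v : σ → ℂ} (c : ℂ) (h : v ∈ D.affineCone) : c • v ∈ D.affineCone := by
  obtain ⟨u, a, b, rfl⟩ := h
  rw [smul_point]
  exact D.point_mem _ _ _

theorem eq_of_mem {v : σ → ℂ} (h : v ∈ D.affineCone) :
    v = D.base (D.baseInv v) + D.seg (D.segInv v) := by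
  obtain ⟨u, a, b, rfl⟩ := h
  simp [point]

theorem minor_eq_zero_of_mem {v : σ → ℂ} (h : v ∈ D.affineCone) (j j' : ι) (k k' : κ) :
    D.segInv v (j, k) * D.segInv v (j', k') - D.segInv v (j, k') * D.segInv v (j', k) = 0 := by
  obtain ⟨u, a, b, rfl⟩ := h
  simp [outer]
  ring

/-- Provides equations: linear ones for the span of base and Segre factor, and the minors. This
makes the cone Zariski closed. -/
theorem mem_affineCone_iff {v : σ → ℂ} : v ∈ D.affineCone ↔
    v = D.base (D.baseInv v) + D.seg (D.segInv v) ∧ ∀ j j' k k',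
      D.segInv v (j, k) * D.segInv v (j', k') - D.segInv v (j, k') * D.segInv v (j', k) = 0 := by
  refine ⟨fun h => ⟨D.eq_of_mem h, D.minor_eq_zero_of_mem h⟩, fun ⟨h1, h2⟩ => ?_⟩
  obtain ⟨a, b, hab⟩ := exists_eq_outer h2
  exact ⟨D.baseInv v, a, b, by rw [point, ← hab]; exact h1⟩

/-- The projective cone over the Segre variety. -/
def projCone : Set (ℙ ℂ (σ → ℂ)) := {p | p.rep ∈ D.affineCone}

theorem mk_mem_projCone {v : σ → ℂ} (h : v ≠ 0) :
    Projectivization.mk ℂ v h ∈ D.projCone ↔ v ∈ D.affineCone := by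
  obtain ⟨c, hc⟩ := Projectivization.exists_smul_eq_mk_rep ℂ v h
  change (Projectivization.mk ℂ v h).rep ∈ D.affineCone ↔ _
  rw [← hc]
  refine ⟨fun h => ?_, fun h => D.smul_mem _ h⟩
  have := D.smul_mem ((c⁻¹ : ℂˣ) : ℂ) h
  rwa [← Units.smul_def, inv_smul_smul] at this

theorem disjoint_range : Disjoint (LinearMap.range D.base) (LinearMap.range D.seg) := by
  rw [Submodule.disjoint_def]
  rintro _ ⟨u, rfl⟩ ⟨M, hM⟩
  have := congrArg D.baseInv hM
  simp at this
  simp [← this]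

/-- Points with `outer a b = 0` form the base; on the span of the base and a Segre point, the scalar
of the Segre point is absorbed into `a`. -/
theorem projCone_eq_coneOver : D.projCone = ProjGeom.coneOver (LinearMap.range D.base)
    (Projectivization.map D.seg D.seg_injective '' ProjGeom.segreVariety ι κ) := by
  ext p
  induction p using Projectivization.ind with
  | h v hv =>
  rw [mk_mem_projCone, ProjGeom.coneOver]
  simp only [Set.mem_union, SetLike.mem_coe, Submodule.mk_mem_projectivization_iff,
    Set.mem_iUnion, exists_prop, Set.exists_mem_image]
  constructor
  · rintro ⟨u, a, b, rfl⟩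
    by_cases h : outer a b = 0
    · left
      exact ⟨u, by simp [point, h]⟩
    · right
      refine ⟨Projectivization.mk ℂ (outer a b) h, ⟨a, b, h, rfl⟩, ?_⟩
      rw [Projectivization.map_mk, Projectivization.submodule_mk]
      exact Submodule.add_mem_sup ⟨u, rfl⟩ (Submodule.mem_span_singleton_self _)
  · rintro (⟨u, rfl⟩ | ⟨_, ⟨a, b, h, rfl⟩, h2⟩)
    · exact D.base_mem u
    · rw [Projectivization.map_mk, Projectivization.submodule_mk] at h2
      obtain ⟨_, ⟨u, rfl⟩, w, hw, rfl⟩ := Submodule.mem_sup.mp h2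
      obtain ⟨c, rfl⟩ := Submodule.mem_span_singleton.mp hw
      refine ⟨u, c • a, b, ?_⟩
      rw [point, ← smul_outer, map_smul]
      rfl

end ConeData

section LinForm

theorem apply_eq_sum_single {τ W : Type*} [Fintype τ] [DecidableEq τ] [AddCommGroup W]
    [Module ℂ W] (f : (τ → ℂ) →ₗ[ℂ] W) (v : τ → ℂ) : f v = ∑ i, v i • f (Pi.single i 1) := by
  rw [LinearMap.pi_apply_eq_sum_univ f v]
  refine Finset.sum_congr rfl fun i _ => ?_
  congr 2
  ext j
  simp [Pi.single_apply, eq_comm]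

variable [Fintype σ]

/-- The linear form in the homogeneous coordinates given by a linear functional. -/
def linForm (f : (σ → ℂ) →ₗ[ℂ] ℂ) : MvPolynomial σ ℂ :=
  open Classical in ∑ i, MvPolynomial.C (f (Pi.single i 1)) * MvPolynomial.X i

theorem aeval_linForm {A : Type*} [CommRing A] [Algebra ℂ A] (f : (σ → ℂ) →ₗ[ℂ] ℂ)
    (v : σ → A) : open Classical in MvPolynomial.aeval v (linForm f) =
      ∑ i, f (Pi.single i 1) • v i := by
  simp [linForm, Algebra.smul_def]

@[simp] theorem eval_linForm (f : (σ → ℂ) →ₗ[ℂ] ℂ) (v : σ → ℂ) :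
    MvPolynomial.eval v (linForm f) = f v := by
  classical
  rw [apply_eq_sum_single f v]
  simp only [linForm, map_sum, map_mul, MvPolynomial.eval_C, MvPolynomial.eval_X, smul_eq_mul]
  exact Finset.sum_congr rfl fun i _ => mul_comm _ _

theorem isHomogeneous_linForm (f : (σ → ℂ) →ₗ[ℂ] ℂ) :
    (linForm f).IsHomogeneous 1 := by
  classical
  refine MvPolynomial.IsHomogeneous.sum _ _ _ fun i _ => ?_
  exact MvPolynomial.isHomogeneous_C_mul_X _ _

end LinForm

end SegreCone

/-! ### Singularity along the base, by tangent vectors and infinitesimal lifting. -/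

namespace SegreCone

open MvPolynomial

section Tangent

variable {σ : Type*}

/-- The `ℂ[ε]`-valued point `a + ε n`. -/
def dualPoint (a n : σ → ℂ) : σ → DualNumber ℂ :=
  fun i => TrivSqZeroExt.inl (a i) + TrivSqZeroExt.inr (n i)

theorem fst_aeval_dualPoint (a n : σ → ℂ) (F : MvPolynomial σ ℂ) :
    (aeval (dualPoint a n) F).fst = eval a F := by
  induction F using MvPolynomial.induction_on with
  | C c => simp [TrivSqZeroExt.algebraMap_eq_inl]
  | add p q hp hq => simp [hp, hq]
  | mul_X p i hp => simp [hp, dualPoint]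

/-- The `ε`-coefficient is the differential of `F` at `a`, which is linear in the direction. -/
theorem snd_aeval_dualPoint_add (a n n' : σ → ℂ) (F : MvPolynomial σ ℂ) :
    (aeval (dualPoint a (n + n')) F).snd =
      (aeval (dualPoint a n) F).snd + (aeval (dualPoint a n') F).snd := by
  induction F using MvPolynomial.induction_on with
  | C c => simp [TrivSqZeroExt.algebraMap_eq_inl]
  | add p q hp hq => simp only [map_add, TrivSqZeroExt.snd_add, hp, hq]; ring
  | mul_X p i hp =>
    simp only [map_mul, aeval_X, TrivSqZeroExt.snd_mul, hp, fst_aeval_dualPoint]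
    simp [dualPoint]
    ring

/-- The restriction of `F` to the line is a polynomial in `t` with all values zero, hence zero; then
substitute `t = ε`. -/
theorem aeval_dualPoint_eq_zero {a n : σ → ℂ} {F : MvPolynomial σ ℂ}
    (h : ∀ t : ℂ, eval (a + t • n) F = 0) : aeval (dualPoint a n) F = 0 := by
  let g : Polynomial ℂ :=
    aeval (fun i => Polynomial.C (a i) + Polynomial.C (n i) * Polynomial.X) F
  have hg : g = 0 := by
    refine Polynomial.funext fun t => ?_
    rw [Polynomial.eval_zero, ← h t]
    have : (Polynomial.aeval t).comp (aeval fun i =>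
        Polynomial.C (a i) + Polynomial.C (n i) * Polynomial.X) = aeval (a + t • n) := by
      ext i
      simp only [AlgHom.comp_apply, aeval_X, map_add, map_mul, Polynomial.aeval_C,
        Polynomial.aeval_X, Pi.add_apply, Pi.smul_apply, smul_eq_mul, mul_comm t]
      rfl
    exact DFunLike.congr_fun this F
  have h2 : aeval (dualPoint a n) F = Polynomial.aeval (DualNumber.eps : DualNumber ℂ) g := by
    rw [← AlgHom.comp_apply]
    congr 1
    ext i : 1
    simp only [aeval_X, AlgHom.comp_apply, map_add, map_mul, Polynomial.aeval_C,
      Polynomial.aeval_X, dualPoint, TrivSqZeroExt.algebraMap_eq_inl]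
    ext <;> simp
  rw [h2, hg, map_zero]

theorem exists_lift_of_surjective {R A B C : Type*} [CommRing R] [CommRing A] [CommRing B]
    [CommRing C] [Algebra R A] [Algebra R B] [Algebra R C] [Algebra.FormallySmooth R A]
    (f : A →ₐ[R] C) (g : B →ₐ[R] C) (hg : Function.Surjective g)
    (hker : ∀ r s, g r = 0 → g s = 0 → r * s = 0) :
    ∃ L : A →ₐ[R] B, ∀ x, g (L x) = f x := by
  have hnil : IsNilpotent (RingHom.ker (g : B →+* C)) := by
    refine ⟨2, ?_⟩
    rw [pow_two, Ideal.zero_eq_bot, eq_bot_iff, Ideal.mul_le]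
    exact fun r hr s hs => hker r s hr hs
  exact ⟨Algebra.FormallySmooth.liftOfSurjective f g hg hnil,
    Algebra.FormallySmooth.liftOfSurjective_apply f g hg hnil⟩

/-- A set is singular at a point `a` if there are two lines through `a` in the set,
and four linear forms whose `2 × 2` determinant vanishes on the set, but not
quadratically on the sum of the directions of the lines. -/
theorem not_smoothAt_of_lines [Fintype σ] {Z : Set (σ → ℂ)} {a : σ → ℂ} (ha : a ∈ Z)
    {n n' : σ → ℂ} (hn : ∀ t : ℂ, a + t • n ∈ Z) (hn' : ∀ t : ℂ, a + t • n' ∈ Z)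
    (f : Fin 2 → Fin 2 → (σ → ℂ) →ₗ[ℂ] ℂ)
    (hf : ∀ v ∈ Z, f 0 0 v * f 1 1 v - f 0 1 v * f 1 0 v = 0)
    (hfa : ∀ i j, f i j a = 0) (hfn : ∀ i j, f i j (n + n') = if i = j then 1 else 0) :
    ¬ ProjGeom.SmoothAt Z a ha := by
  intro hs
  let p := RingHom.ker (ProjGeom.evalAt Z a ha)
  have hs' : Algebra.FormallySmooth ℂ (Localization.AtPrime p) := hs
  -- The sum `n + n'` is tangent to `Z` by linearity of the differential, although the line in this
  -- direction need not lie in `Z`.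
  have hvan : ∀ F ∈ vanishingIdeal ℂ Z, aeval (dualPoint a (n + n')) F = 0 := by
    intro F hF
    ext
    · rw [fst_aeval_dualPoint]
      exact hF a ha
    · rw [snd_aeval_dualPoint_add, aeval_dualPoint_eq_zero (fun t => hF _ (hn t)),
        aeval_dualPoint_eq_zero (fun t => hF _ (hn' t))]
      simp
  let φ : ProjGeom.CoordRing Z →ₐ[ℂ] DualNumber ℂ :=
    Ideal.Quotient.liftₐ _ (aeval (dualPoint a (n + n'))) hvan
  have hφ : ∀ y : p.primeCompl, IsUnit (φ y) := by
    rintro ⟨y, hy⟩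
    obtain ⟨F, rfl⟩ := Ideal.Quotient.mk_surjective y
    rw [TrivSqZeroExt.isUnit_iff_isUnit_fst, isUnit_iff_ne_zero]
    intro h0
    refine hy ?_
    have : (aeval (dualPoint a (n + n')) F).fst = 0 := h0
    rw [fst_aeval_dualPoint] at this
    exact this
  let φ' : Localization.AtPrime p →ₐ[ℂ] DualNumber ℂ :=
    IsLocalization.liftAlgHom (M := p.primeCompl) hφ
  -- The kernel of `ℂ[X]/(X^3) → ℂ[ε]` is generated by `x^2` and has square zero, so smoothness
  -- lifts the tangent vector. Here `x^2` is still nonzero.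
  let I : Ideal (Polynomial ℂ) := Ideal.span {Polynomial.X ^ 3}
  let ev : Polynomial ℂ →ₐ[ℂ] DualNumber ℂ := Polynomial.aeval DualNumber.eps
  have hI : ∀ q ∈ I, ev q = 0 := by
    intro q hq
    obtain ⟨r, rfl⟩ := Ideal.mem_span_singleton.mp hq
    simp [ev, pow_succ]
  let g : (Polynomial ℂ ⧸ I) →ₐ[ℂ] DualNumber ℂ := Ideal.Quotient.liftₐ I ev hI
  have hgmk : ∀ q, g (Ideal.Quotient.mk I q) = ev q := fun q => rfl
  have hgs : Function.Surjective g := by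
    intro x
    refine ⟨Ideal.Quotient.mk I (Polynomial.C x.fst + Polynomial.C x.snd * Polynomial.X), ?_⟩
    rw [hgmk]
    ext <;> simp [ev, TrivSqZeroExt.algebraMap_eq_inl]
  let x : Polynomial ℂ ⧸ I := Ideal.Quotient.mk I Polynomial.X
  have hx3 : x ^ 3 = 0 := by
    rw [← map_pow, Ideal.Quotient.eq_zero_iff_mem]
    exact Ideal.mem_span_singleton_self _
  have hgx : g x = DualNumber.eps := by
    rw [hgmk]
    simp [ev]
  have hker : ∀ b, g b = 0 → ∃ c, b = x ^ 2 * c := by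
    intro b hb
    obtain ⟨q, rfl⟩ := Ideal.Quotient.mk_surjective b
    rw [hgmk] at hb
    have hq := Polynomial.divX_mul_X_add q
    have hq' := Polynomial.divX_mul_X_add q.divX
    rw [← hq'] at hq
    rw [← hq] at hb
    have h0 := congrArg TrivSqZeroExt.fst hb
    have h1 := congrArg TrivSqZeroExt.snd hb
    simp [ev, TrivSqZeroExt.algebraMap_eq_inl] at h0 h1
    refine ⟨Ideal.Quotient.mk I q.divX.divX, ?_⟩
    rw [← map_pow, ← map_mul]
    congr 1
    conv_lhs => rw [← hq]
    simp [h0, h1]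
    ring
  obtain ⟨L, hL⟩ := exists_lift_of_surjective (A := Localization.AtPrime p) φ' g hgs (by
    intro r s hr hs
    obtain ⟨c, rfl⟩ := hker r hr
    obtain ⟨d, rfl⟩ := hker s hs
    linear_combination (x * c * d) * hx3)
  let cls : MvPolynomial σ ℂ →ₐ[ℂ] (Polynomial ℂ ⧸ I) :=
    (L.comp (Algebra.algHom ℂ (ProjGeom.CoordRing Z) (Localization.AtPrime p))).comp
      (Ideal.Quotient.mkₐ ℂ _)
  have hcls : ∀ F, g (cls F) = aeval (dualPoint a (n + n')) F := by
    intro F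
    change g (L _) = _
    rw [hL]
    change IsLocalization.lift _ (algebraMap _ _ _) = _
    rw [IsLocalization.lift_eq]
    rfl
  have hval : ∀ i j, g (cls (linForm (f i j))) = if i = j then DualNumber.eps else 0 := by
    classical
    intro i j
    have h1 : aeval (dualPoint a (n + n')) (linForm (f i j)) =
        TrivSqZeroExt.inl (f i j a) + TrivSqZeroExt.inr (f i j (n + n')) := by
      ext
      · rw [fst_aeval_dualPoint, eval_linForm]
        simp
      · rw [aeval_linForm, TrivSqZeroExt.snd_sum]
        simp only [TrivSqZeroExt.snd_smul, dualPoint, TrivSqZeroExt.snd_add,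
          TrivSqZeroExt.snd_inl, TrivSqZeroExt.snd_inr, zero_add]
        rw [← eval_linForm (f i j) (n + n'), ← coe_aeval_eq_eval, RingHom.coe_coe, aeval_linForm]
    rw [hcls, h1, hfa, hfn]
    split_ifs
    · rw [TrivSqZeroExt.inl_zero, zero_add]
      rfl
    · rw [TrivSqZeroExt.inl_zero, zero_add, TrivSqZeroExt.inr_zero]
  have hdiag : ∀ i, ∃ c, cls (linForm (f i i)) = x + x ^ 2 * c := by
    intro i
    obtain ⟨c, hc⟩ := hker (cls (linForm (f i i)) - x) (by rw [map_sub, hval, hgx]; simp)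
    exact ⟨c, by rw [← hc]; ring⟩
  have hoff : ∀ i j, i ≠ j → ∃ c, cls (linForm (f i j)) = x ^ 2 * c := by
    intro i j hij
    exact hker _ (by rw [hval, if_neg hij])
  have hdet : cls (linForm (f 0 0)) * cls (linForm (f 1 1)) -
      cls (linForm (f 0 1)) * cls (linForm (f 1 0)) = 0 := by
    rw [← map_mul, ← map_mul, ← map_sub]
    have : Ideal.Quotient.mkₐ ℂ (vanishingIdeal ℂ Z) (linForm (f 0 0) * linForm (f 1 1) -
        linForm (f 0 1) * linForm (f 1 0)) = 0 := by
      refine Ideal.Quotient.eq_zero_iff_mem.mpr fun v hv => ?_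
      rw [aeval_eq_eval]
      simpa using hf v hv
    change L (algebraMap _ _ (Ideal.Quotient.mkₐ ℂ (vanishingIdeal ℂ Z) _)) = 0
    rw [this, map_zero, map_zero]
  obtain ⟨c, hc⟩ := hdiag 0
  obtain ⟨d, hd⟩ := hdiag 1
  obtain ⟨e, he⟩ := hoff 0 1 (by decide)
  obtain ⟨e', he'⟩ := hoff 1 0 (by decide)
  rw [hc, hd, he, he'] at hdet
  -- Modulo `x^3`, the diagonal product of the lifted minor is `x^2` and the off-diagonal one is
  -- zero.
  have hx2 : x ^ 2 = 0 := by
    linear_combination hdet - (c + d + x * c * d - x * e * e') * hx3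
  rw [← map_pow, Ideal.Quotient.eq_zero_iff_mem, Ideal.mem_span_singleton,
    Polynomial.X_pow_dvd_iff] at hx2
  simpa using hx2 2 (by norm_num)

end Tangent

namespace ConeData

variable {σ μ ι κ : Type*} (D : ConeData σ μ ι κ)

theorem mem_chart_projCone {i : σ} {a : σ → ℂ} :
    a ∈ ProjGeom.chart D.projCone i ↔ a i = 1 ∧ a ∈ D.affineCone := by
  refine and_congr_right fun h => ⟨fun ⟨h1, h2⟩ => (D.mk_mem_projCone h1).mp h2, fun h2 => ?_⟩
  have h1 : a ≠ 0 := by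
    rintro rfl
    simp at h
  exact ⟨h1, (D.mk_mem_projCone h1).mpr h2⟩

/-- The cone is singular at all points of its base. -/
theorem not_smoothAt_base [Fintype σ] [Nontrivial ι] [Nontrivial κ] (i : σ) (u : μ → ℂ)
    (ha : D.base u ∈ ProjGeom.chart D.projCone i) :
    ¬ ProjGeom.SmoothAt (ProjGeom.chart D.projCone i) (D.base u) ha := by
  classical
  obtain ⟨j, j', hj⟩ := exists_pair_ne ι
  obtain ⟨k, k', hk⟩ := exists_pair_ne κ
  let r : ι → κ → (σ → ℂ) := fun j k => D.seg (outer (Pi.single j 1) (Pi.single k 1))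
  -- The base component cancels the `i`-th coordinate of the elementary matrix, so that the line
  -- stays in the chart.
  let n : ι → κ → (σ → ℂ) := fun j k => D.point (Pi.single (D.last i) (-r j k i))
    (Pi.single j 1) (Pi.single k 1)
  have hn : ∀ j k (t : ℂ), D.base u + t • n j k ∈ ProjGeom.chart D.projCone i := by
    intro j k t
    rw [mem_chart_projCone]
    constructor
    · have := (D.mem_chart_projCone.mp ha).1
      simp only [n, Pi.add_apply, this, Pi.smul_apply, point, base_apply, Pi.single_eq_same, r]
      simp
    · refine ⟨u + t • Pi.single (D.last i) (-r j k i), t • Pi.single j 1, Pi.single k 1, ?_⟩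
      simp only [n, smul_point]
      simp only [point, map_add, add_assoc]
  let J : Fin 2 → ι := ![j, j']
  let K : Fin 2 → κ := ![k, k']
  refine not_smoothAt_of_lines ha (hn j k) (hn j' k')
    (fun s t => (LinearMap.proj (J s, K t)).comp D.segInv) ?_ ?_ ?_
  · intro v hv
    exact D.minor_eq_zero_of_mem (D.mem_chart_projCone.mp hv).2 _ _ _ _
  · intro s t
    simp
  · intro s t
    simp only [n, LinearMap.comp_apply, map_add, segInv_point, LinearMap.proj_apply, outer]
    fin_cases s <;> fin_cases t <;> simp [J, K, hj, hk, hj.symm, hk.symm]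

end ConeData

end SegreCone

/-! ### Smoothness outside the base, and the singular locus. -/

namespace SegreCone

open MvPolynomial

/-- If a formally smooth algebra `P` embeds in `A` and the embedding becomes an isomorphism
after inverting an element `x` of `P` outside the prime `p`, then `A` is smooth at `p`. -/
theorem isSmoothAt_of_injective {R P A : Type*} [CommRing R] [CommRing P] [CommRing A]
    [Algebra R P] [Algebra R A] [Algebra.FormallySmooth R P] (φ : P →ₐ[R] A)
    (hφ : Function.Injective φ) (p : Ideal A) [p.IsPrime] (x : P) (hx : φ x ∉ p)
    (h : ∀ a, ∃ (n : ℕ) (g : P), φ x ^ n * a = φ g) : Algebra.IsSmoothAt R p := by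
  let : Algebra P (Localization.AtPrime p) :=
    ((algebraMap A (Localization.AtPrime p)).comp φ.toRingHom).toAlgebra
  have hmap : ∀ g, algebraMap P (Localization.AtPrime p) g =
    algebraMap A (Localization.AtPrime p) (φ g) := fun g => rfl
  have : IsScalarTower R P (Localization.AtPrime p) := IsScalarTower.of_algebraMap_eq fun r => by
    rw [hmap, φ.commutes, ← IsScalarTower.algebraMap_apply]
  let M : Submonoid P := p.primeCompl.comap φ
  have hxM : ∀ n, φ x ^ n ∈ p.primeCompl := fun n => pow_mem (S := p.primeCompl) hx n
  -- Numerators and denominators from `A` are brought into `P` by multiplying with powers of the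
  -- unit `φ x`.
  have : IsLocalization M (Localization.AtPrime p) :=
    { map_units := fun y => IsLocalization.map_units (M := p.primeCompl) _ ⟨φ y, y.2⟩
      surj := by
        intro z
        obtain ⟨⟨a, s⟩, hz⟩ := IsLocalization.surj p.primeCompl z
        obtain ⟨n, g, hg⟩ := h a
        obtain ⟨n', g', hg'⟩ := h s
        have hg'' : φ g' ∈ p.primeCompl := by
          rw [← hg']
          exact mul_mem (hxM n') s.2
        have hxg : φ (x ^ n * g') ∈ p.primeCompl := by
          rw [map_mul, map_pow]
          exact mul_mem (hxM n) hg''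
        refine ⟨⟨x ^ n' * g, x ^ n * g', hxg⟩, ?_⟩
        simp only [hmap, map_mul, map_pow, ← hg, ← hg']
        simp only at hz
        rw [← hz]
        ring
      exists_of_eq := by
        intro g g' hgg
        rw [hmap, hmap] at hgg
        obtain ⟨s, hs⟩ := (IsLocalization.eq_iff_exists p.primeCompl _).mp hgg
        obtain ⟨n, c, hc⟩ := h s
        refine ⟨⟨c, ?_⟩, hφ ?_⟩
        · change φ c ∈ p.primeCompl
          rw [← hc]
          exact mul_mem (hxM n) s.2
        · rw [map_mul, map_mul, ← hc, mul_assoc, hs, mul_assoc] }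
  have : Algebra.FormallySmooth P (Localization.AtPrime p) :=
    Algebra.FormallySmooth.of_isLocalization M
  exact Algebra.FormallySmooth.comp R P (Localization.AtPrime p)

namespace ConeData

variable {σ μ ι κ : Type*} (D : ConeData σ μ ι κ) [Fintype σ]

/-- The affine coordinates of the chart `i` of the cone near a point where the matrix
coordinate `(j, k)` does not vanish: the coordinates of the base that are not eliminated in
this chart, and the column and the row of the matrix through this entry. -/
def localCoord (i : σ) (j : ι) (k : κ) :
    {s // s ≠ D.last i} ⊕ ι ⊕ {k' // k' ≠ k} → (σ → ℂ) →ₗ[ℂ] ℂ :=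
  Sum.elim (fun s => (LinearMap.proj s.1).comp D.baseInv)
    (Sum.elim (fun j' => (LinearMap.proj (j', k)).comp D.segInv)
      (fun k' => (LinearMap.proj (j, k'.1)).comp D.segInv))

/-- The inclusion of the polynomial ring on the local coordinates in the coordinate ring. -/
def localHom (i : σ) (j : ι) (k : κ) :
    MvPolynomial ({s // s ≠ D.last i} ⊕ ι ⊕ {k' // k' ≠ k}) ℂ →ₐ[ℂ]
      ProjGeom.CoordRing (ProjGeom.chart D.projCone i) :=
  (Ideal.Quotient.mkₐ ℂ _).comp (aeval fun x => linForm (D.localCoord i j k x))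

theorem localHom_X (i : σ) (j : ι) (k : κ) (x) :
    D.localHom i j k (X x) = Ideal.Quotient.mkₐ ℂ _ (linForm (D.localCoord i j k x)) := by
  rw [localHom, AlgHom.comp_apply, aeval_X]

omit [Fintype σ] in
theorem mk_eq_mk_of_eval_eq {Z : Set (σ → ℂ)} {F G : MvPolynomial σ ℂ}
    (h : ∀ v ∈ Z, eval v F = eval v G) :
    Ideal.Quotient.mkₐ ℂ (vanishingIdeal ℂ Z) F = Ideal.Quotient.mkₐ ℂ (vanishingIdeal ℂ Z) G := by
  refine Ideal.Quotient.eq.mpr fun v hv => ?_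
  rw [aeval_eq_eval, map_sub, sub_eq_zero]
  exact h v hv

/-- The local coordinates can be prescribed freely as long as the one at `(j, k)` is nonzero. Hence
`g` times this coordinate vanishes at every point. -/
theorem localHom_injective (i : σ) (j : ι) (k : κ) : Function.Injective (D.localHom i j k) := by
  classical
  rw [injective_iff_map_eq_zero]
  intro g hg
  have hx : (X (Sum.inr (Sum.inl j)) : MvPolynomial
    ({s // s ≠ D.last i} ⊕ ι ⊕ {k' // k' ≠ k}) ℂ) ≠ 0 := X_ne_zero _
  refine (mul_eq_zero.mp (?_ : g * X (Sum.inr (Sum.inl j)) = 0)).resolve_right hx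
  refine MvPolynomial.funext fun y => ?_
  rw [map_mul, eval_X, map_zero]
  by_cases hy : y (Sum.inr (Sum.inl j)) = 0
  · rw [hy, mul_zero]
  have hgv : ∀ v ∈ ProjGeom.chart D.projCone i, eval (fun x => D.localCoord i j k x v) g = 0 := by
    intro v hv
    have h1 := Ideal.Quotient.eq_zero_iff_mem.mp hg v hv
    rw [aeval_eq_eval] at h1
    have : (aeval v).comp (aeval fun x => linForm (D.localCoord i j k x)) =
        aeval (R := ℂ) (fun x => D.localCoord i j k x v) := by
      ext x
      simp
    rw [← h1, ← aeval_eq_eval, ← aeval_eq_eval, ← this]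
    rfl
  let a : ι → ℂ := fun j' => y (Sum.inr (Sum.inl j'))
  let b : κ → ℂ := fun k' =>
    if h : k' ≠ k then y (Sum.inr (Sum.inr ⟨k', h⟩)) / y (Sum.inr (Sum.inl j)) else 1
  -- The entry at `D.last i` is the one eliminated in the chart: it is chosen to make the `i`-th
  -- coordinate of the point `1`.
  let u : μ → ℂ := fun s =>
    if h : s ≠ D.last i then y (Sum.inl ⟨s, h⟩) else 1 - D.seg (outer a b) i
  have hv : D.point u a b ∈ ProjGeom.chart D.projCone i := by
    rw [mem_chart_projCone]
    refine ⟨?_, D.point_mem _ _ _⟩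
    simp [point, u]
  have := hgv _ hv
  have hco : (fun x => D.localCoord i j k x (D.point u a b)) = y := by
    ext x
    rcases x with ⟨s, hs⟩ | j' | ⟨k', hk'⟩
    · simp [localCoord, u, hs]
    · simp [localCoord, outer, a, b]
    · simp only [localCoord, Sum.elim_inr, LinearMap.comp_apply, segInv_point,
        LinearMap.proj_apply, outer, a, b, dif_pos hk']
      field_simp
  rw [hco] at this
  rw [this, zero_mul]

/-- The functions with this property form a subalgebra, so it suffices to treat coordinates. The
minor through `(j, k)` expresses every other matrix entry after one multiplication, and the equation
of the chart recovers the eliminated base coordinate. -/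
theorem exists_localHom_eq [Finite μ] [Finite ι] [Finite κ] (i : σ) (j : ι) (k : κ)
    (f : ProjGeom.CoordRing (ProjGeom.chart D.projCone i)) :
    ∃ n g, D.localHom i j k (X (Sum.inr (Sum.inl j))) ^ n * f = D.localHom i j k g := by
  classical
  have := Fintype.ofFinite μ
  have := Fintype.ofFinite ι
  have := Fintype.ofFinite κ
  set φ := D.localHom i j k
  set x : MvPolynomial ({s // s ≠ D.last i} ⊕ ι ⊕ {k' // k' ≠ k}) ℂ := X (Sum.inr (Sum.inl j))
    with hx
  let S : Subalgebra ℂ (ProjGeom.CoordRing (ProjGeom.chart D.projCone i)) :=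
    { carrier := {f | ∃ n g, φ x ^ n * f = φ g}
      mul_mem' := by
        rintro f f' ⟨n, g, h⟩ ⟨n', g', h'⟩
        refine ⟨n + n', g * g', ?_⟩
        rw [map_mul, ← h, ← h']
        ring
      add_mem' := by
        rintro f f' ⟨n, g, h⟩ ⟨n', g', h'⟩
        refine ⟨n + n', x ^ n' * g + x ^ n * g', ?_⟩
        simp only [map_add, map_mul, map_pow, ← h, ← h']
        ring
      algebraMap_mem' := fun c => ⟨0, algebraMap _ _ c, by simp⟩ }
  have hrange : ∀ g, φ g ∈ S := fun g => ⟨0, g, by simp⟩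
  let cls := Ideal.Quotient.mkₐ ℂ (vanishingIdeal ℂ (ProjGeom.chart D.projCone i))
  have hcoord : ∀ y, cls (linForm (D.localCoord i j k y)) ∈ S := by
    intro y
    rw [← localHom_X]
    exact hrange _
  have hM : ∀ p : ι × κ, cls (linForm ((LinearMap.proj p).comp D.segInv)) ∈ S := by
    rintro ⟨j', k'⟩
    by_cases hk : k' = k
    · subst hk
      exact hcoord (Sum.inr (Sum.inl j'))
    · refine ⟨1, X (Sum.inr (Sum.inl j')) * X (Sum.inr (Sum.inr ⟨k', hk⟩)), ?_⟩
      rw [map_mul, pow_one, localHom_X, localHom_X, localHom_X, ← map_mul, ← map_mul]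
      refine mk_eq_mk_of_eval_eq fun v hv => ?_
      have := D.minor_eq_zero_of_mem (D.mem_chart_projCone.mp hv).2 j j' k k'
      simp only [localCoord, map_mul, eval_linForm, Sum.elim_inr, Sum.elim_inl,
        LinearMap.comp_apply, LinearMap.proj_apply]
      linear_combination this
  let segForm : σ → MvPolynomial σ ℂ := fun t =>
    ∑ p : ι × κ, D.seg (Pi.single p 1) t • linForm ((LinearMap.proj p).comp D.segInv)
  have hsegForm : ∀ t v, eval v (segForm t) = D.seg (D.segInv v) t := by
    intro t v
    simp only [segForm, map_sum, smul_eval, eval_linForm, LinearMap.comp_apply,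
      LinearMap.proj_apply]
    rw [apply_eq_sum_single D.seg (D.segInv v)]
    simp only [Finset.sum_apply, Pi.smul_apply, smul_eq_mul]
    exact Finset.sum_congr rfl fun p _ => mul_comm _ _
  have hseg : ∀ t, cls (segForm t) ∈ S := by
    intro t
    simp only [segForm, map_sum, map_smul]
    exact S.sum_mem fun p _ => S.smul_mem (hM p) _
  have hu : ∀ s : μ, cls (linForm ((LinearMap.proj s).comp D.baseInv)) ∈ S := by
    intro s
    by_cases hs : s = D.last i
    · have : cls (linForm ((LinearMap.proj s).comp D.baseInv)) = cls (1 - segForm i) := by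
        refine mk_eq_mk_of_eval_eq fun v hv => ?_
        obtain ⟨h1, h2⟩ := D.mem_chart_projCone.mp hv
        have := congrFun (D.eq_of_mem h2) i
        rw [Pi.add_apply, base_apply, h1] at this
        simp only [eval_linForm, LinearMap.comp_apply, LinearMap.proj_apply, hs, map_sub, map_one,
          hsegForm]
        linear_combination -this
      rw [this, map_sub, map_one]
      exact S.sub_mem S.one_mem (hseg i)
    · exact hcoord (Sum.inl ⟨s, hs⟩)
  obtain ⟨F, rfl⟩ := Ideal.Quotient.mkₐ_surjective ℂ _ f
  change cls F ∈ S
  induction F using MvPolynomial.induction_on with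
  | C c => exact S.algebraMap_mem c
  | add p q hp hq => rw [map_add]; exact S.add_mem hp hq
  | mul_X p t hp =>
    rw [map_mul]
    refine S.mul_mem hp ?_
    have : cls (X t) = cls (linForm ((LinearMap.proj (D.last t)).comp D.baseInv) + segForm t) := by
      refine mk_eq_mk_of_eval_eq fun v hv => ?_
      have := congrFun (D.eq_of_mem (D.mem_chart_projCone.mp hv).2) t
      rw [Pi.add_apply, base_apply] at this
      simpa [hsegForm] using this
    rw [this, map_add]
    exact S.add_mem (hu _) (hseg _)

/-- The cone is smooth outside its base. -/
theorem smoothAt_of_segInv_ne_zero [Finite μ] [Finite ι] [Finite κ] {i : σ} {a : σ → ℂ}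
    (ha : a ∈ ProjGeom.chart D.projCone i) {j : ι} {k : κ} (h : D.segInv a (j, k) ≠ 0) :
    ProjGeom.SmoothAt (ProjGeom.chart D.projCone i) a ha := by
  refine isSmoothAt_of_injective (D.localHom i j k) (D.localHom_injective i j k) _
    (X (Sum.inr (Sum.inl j))) ?_ (D.exists_localHom_eq i j k)
  rw [localHom_X, RingHom.mem_ker]
  change aeval a (linForm _) ≠ 0
  rw [aeval_eq_eval, eval_linForm]
  exact h

theorem singularLocus_projCone [Finite μ] [Finite ι] [Finite κ] [Nontrivial ι] [Nontrivial κ] :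
    ProjGeom.singularLocus D.projCone =
      ((LinearMap.range D.base).projectivization : Set (ℙ ℂ (σ → ℂ))) := by
  ext p
  induction p using Projectivization.ind with
  | h v hv =>
  simp only [ProjGeom.singularLocus, Set.mem_ofPred_eq, SetLike.mem_coe,
    Submodule.mk_mem_projectivization_iff, mk_mem_projCone]
  constructor
  · rintro ⟨hmem, hsing⟩
    by_contra hnot
    have hseg : D.segInv v ≠ 0 := by
      intro h0
      have := D.eq_of_mem hmem
      rw [h0, map_zero, add_zero] at this
      exact hnot ⟨_, this.symm⟩
    obtain ⟨⟨j, k⟩, hjk⟩ := Function.ne_iff.mp hseg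
    obtain ⟨i, hi⟩ := Function.ne_iff.mp hv
    have hi' : v i ≠ 0 := hi
    have ha : (v i)⁻¹ • v ∈ ProjGeom.chart D.projCone i := by
      rw [mem_chart_projCone]
      exact ⟨by simp [hi'], D.smul_mem _ hmem⟩
    refine hsing ⟨i, (v i)⁻¹ • v, ha, smul_ne_zero (inv_ne_zero hi') hv, ?_,
      D.smoothAt_of_segInv_ne_zero ha (j := j) (k := k) ?_⟩
    · rw [Projectivization.mk_eq_mk_iff']
      exact ⟨v i, by simp [hi']⟩
    · rw [map_smul, Pi.smul_apply]
      exact mul_ne_zero (inv_ne_zero hi') hjk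
  · rintro ⟨u, rfl⟩
    refine ⟨D.base_mem u, ?_⟩
    rintro ⟨i, a, ha, h, heq, hsm⟩
    obtain ⟨c, hc⟩ := (Projectivization.mk_eq_mk_iff' ℂ _ _ h hv).mp heq.symm
    rw [← map_smul] at hc
    subst hc
    exact D.not_smoothAt_base i _ ha hsm

end ConeData

end SegreCone

/-! ### The Hilbert function of the cone. -/

namespace SegreCone

open MvPolynomial

theorem eval_smul_of_isHomogeneous {σ : Type*} {F : MvPolynomial σ ℂ} {n : ℕ}
    (hF : F.IsHomogeneous n) (c : ℂ) (v : σ → ℂ) : eval (c • v) F = c ^ n * eval v F := by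
  rw [eval_eq, eval_eq, Finset.mul_sum]
  refine Finset.sum_congr rfl fun d hd => ?_
  simp only [Pi.smul_apply, smul_eq_mul, mul_pow, Finset.prod_mul_distrib, Finset.prod_pow_eq_pow_sum]
  rw [hF.degree_eq_sum_deg_support hd]
  ring

theorem eval_rep_eq_zero_iff {σ : Type*} {F : MvPolynomial σ ℂ} {n : ℕ}
    (hF : F.IsHomogeneous n) {v : σ → ℂ} (hv : v ≠ 0) :
    eval (Projectivization.mk ℂ v hv).rep F = 0 ↔ eval v F = 0 := by
  obtain ⟨c, hc⟩ := Projectivization.exists_smul_eq_mk_rep ℂ v hv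
  rw [← hc, Units.smul_def, eval_smul_of_isHomogeneous hF, mul_eq_zero]
  simp

/-- The bidegree on the parameters of the cone: the coordinates of the base have
bidegree `(1, 1)`, those of the two factors of the Segre variety `(1, 0)` and `(0, 1)`. -/
def bidegree (μ ι κ : Type*) : μ ⊕ ι ⊕ κ → ℕ × ℕ :=
  Sum.elim (fun _ => (1, 1)) (Sum.elim (fun _ => (1, 0)) (fun _ => (0, 1)))

theorem weight_bidegree {μ ι κ : Type*} [Fintype μ] [Fintype ι] [Fintype κ]
    (d : μ ⊕ ι ⊕ κ →₀ ℕ) : Finsupp.weight (bidegree μ ι κ) d =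
      (∑ s, d (Sum.inl s) + ∑ j, d (Sum.inr (Sum.inl j)),
        ∑ s, d (Sum.inl s) + ∑ k, d (Sum.inr (Sum.inr k))) := by
  rw [Finsupp.weight_apply, Finsupp.sum_fintype _ _ (by simp), Fintype.sum_sum_type,
    Fintype.sum_sum_type]
  simp [bidegree, Prod.ext_iff, Prod.fst_sum, Prod.snd_sum]

/-- Monomials form a basis. If the base variables contribute degree `x.1`, then both Segre factors
must contribute `x.2 = n - x.1`. -/
theorem finrank_bidegree (μ ι κ : Type*) [Fintype μ] [Fintype ι] [Fintype κ] (n : ℕ) :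
    Module.finrank ℂ (weightedHomogeneousSubmodule ℂ (bidegree μ ι κ) (n, n)) =
      ∑ x ∈ Finset.HasAntidiagonal.antidiagonal n, (Fintype.card μ).multichoose x.1 *
        ((Fintype.card ι).multichoose x.2 * (Fintype.card κ).multichoose x.2) := by
  classical
  have h1 : weightedHomogeneousSubmodule ℂ (bidegree μ ι κ) (n, n) =
      restrictSupport ℂ {d | Finsupp.weight (bidegree μ ι κ) d = (n, n)} :=
    weightedHomogeneousSubmodule_eq_finsupp_supported ℂ _ _
  rw [h1, Module.finrank_eq_nat_card_basis (basisRestrictSupport ℂ _)]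
  let A : Finset (Σ _ : ℕ × ℕ, (μ →₀ ℕ) × (ι →₀ ℕ) × (κ →₀ ℕ)) :=
    (Finset.HasAntidiagonal.antidiagonal n).sigma fun x => Finset.univ.finsuppAntidiag x.1 ×ˢ
      Finset.univ.finsuppAntidiag x.2 ×ˢ Finset.univ.finsuppAntidiag x.2
  have hA : A.card = ∑ x ∈ Finset.HasAntidiagonal.antidiagonal n, (Fintype.card μ).multichoose x.1 *
        ((Fintype.card ι).multichoose x.2 * (Fintype.card κ).multichoose x.2) := by
    simp only [A, Finset.card_sigma, Finset.card_product,
      Finset.card_finsuppAntidiag_nat_eq_multichoose, Finset.card_univ]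
  rw [← hA, ← Nat.card_eq_finsetCard]
  have hmem : ∀ x y z p, (⟨p, x, y, z⟩ : Σ _ : ℕ × ℕ, (μ →₀ ℕ) × (ι →₀ ℕ) × (κ →₀ ℕ)) ∈ A ↔
      p.1 + p.2 = n ∧ ∑ s, x s = p.1 ∧ ∑ j, y j = p.2 ∧ ∑ k, z k = p.2 := by
    intro x y z p
    simp [A]
  refine Nat.card_congr
    { toFun := fun d => ⟨⟨(∑ s, d.1 (Sum.inl s), ∑ j, d.1 (Sum.inr (Sum.inl j))),
        (Finsupp.sumFinsuppEquivProdFinsupp d.1).1,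
        Finsupp.sumFinsuppEquivProdFinsupp (Finsupp.sumFinsuppEquivProdFinsupp d.1).2⟩, ?_⟩
      invFun := fun e => ⟨Finsupp.sumFinsuppEquivProdFinsupp.symm
        (e.1.2.1, Finsupp.sumFinsuppEquivProdFinsupp.symm e.1.2.2), ?_⟩
      left_inv := fun d => ?_
      right_inv := fun e => ?_ }
  · have hd := d.2
    rw [Set.mem_ofPred_eq, weight_bidegree, Prod.mk.injEq] at hd
    refine (hmem _ _ _ _).mpr ⟨hd.1, rfl, rfl, ?_⟩
    change ∑ k, d.1 (Sum.inr (Sum.inr k)) = ∑ j, d.1 (Sum.inr (Sum.inl j))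
    omega
  · obtain ⟨⟨p, x, y, z⟩, he⟩ := e
    obtain ⟨h1, h2, h3, h4⟩ := (hmem _ _ _ _).mp he
    rw [Set.mem_ofPred_eq, weight_bidegree]
    simp only [Finsupp.sumFinsuppEquivProdFinsupp_symm_inl,
      Finsupp.sumFinsuppEquivProdFinsupp_symm_inr, h2, h3, h4, h1]
  · ext (s | j | k) <;> rfl
  · obtain ⟨⟨p, x, y, z⟩, he⟩ := e
    obtain ⟨h1, h2, h3, h4⟩ := (hmem _ _ _ _).mp he
    have hp : p = (∑ s, x s, ∑ j, y j) := Prod.ext h2.symm h3.symm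
    subst hp
    simp

namespace ConeData

variable {σ μ ι κ : Type*} (D : ConeData σ μ ι κ)

section

variable [Fintype ι] [Fintype κ]

/-- The generic point of the affine cone. -/
def genericPoint (t : σ) : MvPolynomial (μ ⊕ ι ⊕ κ) ℂ :=
  open Classical in X (Sum.inl (D.last t)) + ∑ p : ι × κ,
    C (D.seg (Pi.single p 1) t) * (X (Sum.inr (Sum.inl p.1)) * X (Sum.inr (Sum.inr p.2)))

/-- The pullback of polynomials along the parametrization of the affine cone. -/
def pullback : MvPolynomial σ ℂ →ₐ[ℂ] MvPolynomial (μ ⊕ ι ⊕ κ) ℂ := aeval D.genericPoint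

theorem eval_genericPoint (y : μ ⊕ ι ⊕ κ → ℂ) (t : σ) : eval y (D.genericPoint t) =
    D.point (fun s => y (Sum.inl s)) (fun j => y (Sum.inr (Sum.inl j)))
      (fun k => y (Sum.inr (Sum.inr k))) t := by
  classical
  rw [point, Pi.add_apply, base_apply, apply_eq_sum_single D.seg]
  simp only [genericPoint, map_add, map_sum, map_mul, eval_X, eval_C, Finset.sum_apply,
    Pi.smul_apply, smul_eq_mul, outer]
  congr 1
  exact Finset.sum_congr rfl fun p _ => mul_comm _ _

theorem eval_pullback (y : μ ⊕ ι ⊕ κ → ℂ) (F : MvPolynomial σ ℂ) : eval y (D.pullback F) =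
    eval (D.point (fun s => y (Sum.inl s)) (fun j => y (Sum.inr (Sum.inl j)))
      (fun k => y (Sum.inr (Sum.inr k)))) F := by
  have : (aeval y).comp D.pullback = aeval (R := ℂ) (D.point (fun s => y (Sum.inl s))
      (fun j => y (Sum.inr (Sum.inl j))) (fun k => y (Sum.inr (Sum.inr k)))) := by
    ext t
    simp only [pullback, AlgHom.comp_apply, aeval_X]
    rw [aeval_eq_eval, eval_genericPoint]
  rw [← aeval_eq_eval, ← aeval_eq_eval, ← this]
  rfl

/-- The parametrization is onto the affine cone, and a polynomial over an infinite field is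
determined by its values. -/
theorem pullback_eq_zero_iff (F : MvPolynomial σ ℂ) :
    D.pullback F = 0 ↔ ∀ v ∈ D.affineCone, eval v F = 0 := by
  constructor
  · rintro h _ ⟨u, a, b, rfl⟩
    have := D.eval_pullback (Sum.elim u (Sum.elim a b)) F
    rw [h, map_zero] at this
    exact this.symm
  · intro h
    refine MvPolynomial.funext fun y => ?_
    rw [eval_pullback, map_zero]
    exact h _ (D.point_mem _ _ _)

theorem isWeightedHomogeneous_genericPoint (t : σ) :
    IsWeightedHomogeneous (bidegree μ ι κ) (D.genericPoint t) (1, 1) := by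
  classical
  refine (isWeightedHomogeneous_X ℂ _ (Sum.inl (D.last t))).add
    (.sum _ _ _ fun p _ => .C_mul ?_ _)
  exact (isWeightedHomogeneous_X ℂ _ _).mul (isWeightedHomogeneous_X ℂ _ _)

theorem isWeightedHomogeneous_pullback {F : MvPolynomial σ ℂ} {n : ℕ} (hF : F.IsHomogeneous n) :
    IsWeightedHomogeneous (bidegree μ ι κ) (D.pullback F) (n, n) := by
  rw [pullback, aeval_def, eval₂_eq]
  refine .sum _ _ _ fun d hd => .C_mul ?_ _
  have : (n, n) = ∑ i ∈ d.support, d i • ((1, 1) : ℕ × ℕ) := by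
    rw [hF.degree_eq_sum_deg_support hd]
    simp [Prod.ext_iff, Prod.fst_sum, Prod.snd_sum]
  rw [this]
  exact .prod _ _ _ fun i _ => (D.isWeightedHomogeneous_genericPoint i).pow _

theorem pullback_linForm_base [Fintype σ] (s : μ) :
    D.pullback (linForm ((LinearMap.proj s).comp D.baseInv)) = X (Sum.inl s) := by
  refine MvPolynomial.funext fun y => ?_
  rw [eval_pullback]
  simp

theorem pullback_linForm_seg [Fintype σ] (j : ι) (k : κ) :
    D.pullback (linForm ((LinearMap.proj (j, k)).comp D.segInv)) =
      X (Sum.inr (Sum.inl j)) * X (Sum.inr (Sum.inr k)) := by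
  refine MvPolynomial.funext fun y => ?_
  rw [eval_pullback]
  simp [outer]

end

section

variable [Fintype σ] [Fintype μ] [Fintype ι] [Fintype κ]

/-- Such a monomial is a product of `n` factors of bidegree `(1, 1)`, each a base variable or a
product of one variable from each Segre factor, and these are pullbacks of linear forms. -/
theorem exists_pullback_eq_monomial (n : ℕ) (d : μ ⊕ ι ⊕ κ →₀ ℕ)
    (hd : Finsupp.weight (bidegree μ ι κ) d = (n, n)) :
    ∃ F : MvPolynomial σ ℂ, F.IsHomogeneous n ∧ D.pullback F = monomial d 1 := by
  classical
  induction n generalizing d with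
  | zero =>
    refine ⟨1, isHomogeneous_one _ _, ?_⟩
    rw [map_one]
    rw [weight_bidegree] at hd
    have : d = 0 := by
      simp only [Prod.mk.injEq, Nat.add_eq_zero_iff, Finset.sum_eq_zero_iff, Finset.mem_univ,
        true_imp_iff] at hd
      ext (s | j | k)
      · exact hd.1.1 s
      · exact hd.1.2 j
      · exact hd.2.2 k
    rw [this]
    rfl
  | succ n ih =>
    have key : ∀ e, e ≤ d → Finsupp.weight (bidegree μ ι κ) e = (1, 1) →
        (∃ G : MvPolynomial σ ℂ, G.IsHomogeneous 1 ∧ D.pullback G = monomial e 1) →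
        ∃ F : MvPolynomial σ ℂ, F.IsHomogeneous (n + 1) ∧ D.pullback F = monomial d 1 := by
      rintro e he hwe ⟨G, hG, hGe⟩
      obtain ⟨e', rfl⟩ := exists_add_of_le he
      rw [map_add, hwe] at hd
      have h1 := congrArg Prod.fst hd
      have h2 := congrArg Prod.snd hd
      simp only [Prod.fst_add, Prod.snd_add] at h1 h2
      obtain ⟨F, hF, hFe⟩ := ih e' (Prod.ext (by dsimp only; omega) (by dsimp only; omega))
      refine ⟨G * F, by rw [add_comm n]; exact hG.mul hF, ?_⟩
      rw [map_mul, hGe, hFe, monomial_mul, one_mul]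
    rw [weight_bidegree, Prod.mk.injEq] at hd
    by_cases hs : 0 < ∑ s, d (Sum.inl s)
    · obtain ⟨s, -, hs⟩ := Finset.sum_pos_iff.mp hs
      refine key (Finsupp.single (Sum.inl s) 1) (Finsupp.single_le_iff.mpr hs) ?_
        ⟨_, isHomogeneous_linForm _, D.pullback_linForm_base s⟩
      simp [Finsupp.weight_apply, bidegree]
    · have hj : 0 < ∑ j, d (Sum.inr (Sum.inl j)) := by omega
      have hk : 0 < ∑ k, d (Sum.inr (Sum.inr k)) := by omega
      obtain ⟨j, -, hj⟩ := Finset.sum_pos_iff.mp hj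
      obtain ⟨k, -, hk⟩ := Finset.sum_pos_iff.mp hk
      refine key (Finsupp.single (Sum.inr (Sum.inl j)) 1 + Finsupp.single (Sum.inr (Sum.inr k)) 1)
        ?_ ?_ ⟨_, isHomogeneous_linForm ((LinearMap.proj (j, k)).comp D.segInv), ?_⟩
      · intro x
        rcases x with s | j' | k'
        · simp
        · by_cases h : j = j'
          · subst h
            simpa using Nat.one_le_iff_ne_zero.mpr hj.ne'
          · simp [h]
        · by_cases h : k = k'
          · subst h
            simpa using Nat.one_le_iff_ne_zero.mpr hk.ne'
          · simp [h]
      · rw [map_add]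
        simp [Finsupp.weight_apply, bidegree]
      · rw [pullback_linForm_seg]
        simp [X, monomial_mul]

theorem map_pullback_homogeneousSubmodule (n : ℕ) :
    (homogeneousSubmodule σ ℂ n).map D.pullback.toLinearMap =
      weightedHomogeneousSubmodule ℂ (bidegree μ ι κ) (n, n) := by
  apply le_antisymm
  · rintro _ ⟨F, hF, rfl⟩
    exact D.isWeightedHomogeneous_pullback hF
  · have h1 : weightedHomogeneousSubmodule ℂ (bidegree μ ι κ) (n, n) =
        restrictSupport ℂ {d | Finsupp.weight (bidegree μ ι κ) d = (n, n)} :=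
      weightedHomogeneousSubmodule_eq_finsupp_supported ℂ _ _
    rw [h1, restrictSupport_eq_span, Submodule.span_le]
    rintro _ ⟨d, hd, rfl⟩
    obtain ⟨F, hF, h⟩ := D.exists_pullback_eq_monomial n d hd
    exact ⟨F, hF, h⟩

-- Projective points only test nonzero vectors. Multiplying by a base variable, available as `μ` is
-- nonempty, disposes of the parameters where `D.point` could be zero.
omit [Fintype σ] [Fintype μ] in
theorem mem_vanishingForms_iff [Nonempty μ] {n : ℕ} (F : homogeneousSubmodule σ ℂ n) :
    F ∈ ProjGeom.vanishingForms D.projCone n ↔ D.pullback F.1 = 0 := by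
  change (∀ p ∈ D.projCone, eval p.rep F.1 = 0) ↔ _
  constructor
  · intro h
    obtain ⟨s⟩ := ‹Nonempty μ›
    refine (mul_eq_zero.mp (?_ : D.pullback F.1 * X (Sum.inl s) = 0)).resolve_right (X_ne_zero _)
    refine MvPolynomial.funext fun y => ?_
    rw [map_mul, eval_X, map_zero, eval_pullback]
    by_cases hy : y (Sum.inl s) = 0
    · rw [hy, mul_zero]
    set v := D.point (fun s => y (Sum.inl s)) (fun j => y (Sum.inr (Sum.inl j)))
      (fun k => y (Sum.inr (Sum.inr k))) with hv
    have hv0 : v ≠ 0 := by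
      intro h0
      have := congrArg D.baseInv hv
      rw [h0, baseInv_point, map_zero] at this
      exact hy (congrFun this s).symm
    rw [(eval_rep_eq_zero_iff F.2 hv0).mp (h _ ((D.mk_mem_projCone hv0).mpr (D.point_mem _ _ _))),
      zero_mul]
  · intro h p hp
    exact (D.pullback_eq_zero_iff _).mp h _ hp

theorem hilbertFunction_projCone [Nonempty μ] (n : ℕ) :
    ProjGeom.hilbertFunction D.projCone n = ∑ x ∈ Finset.HasAntidiagonal.antidiagonal n,
      (Fintype.card μ).multichoose x.1 *
        ((Fintype.card ι).multichoose x.2 * (Fintype.card κ).multichoose x.2) := by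
  rw [← finrank_bidegree, ProjGeom.hilbertFunction]
  let f := D.pullback.toLinearMap.domRestrict (homogeneousSubmodule σ ℂ n)
  have hker : ProjGeom.vanishingForms D.projCone n = LinearMap.ker f := by
    ext F
    exact D.mem_vanishingForms_iff F
  rw [hker, f.quotKerEquivRange.finrank_eq, ← D.map_pullback_homogeneousSubmodule,
    LinearMap.range_domRestrict]

end

end ConeData

end SegreCone

/-! ### Polynomial functions with normalised leading coefficient. -/

open Finset

/-- The function `f` is a polynomial of degree at most `D` whose coefficient in degree `D` is
`c / D!`. -/
def IsPolynomialWith (f : ℕ → ℚ) (D : ℕ) (c : ℚ) : Prop :=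
  ∃ P : Polynomial ℚ, (∀ n : ℕ, f n = P.eval (n : ℚ)) ∧ P.natDegree ≤ D ∧
    P.coeff D * (D.factorial : ℚ) = c

namespace IsPolynomialWith

theorem one : IsPolynomialWith 1 0 1 := ⟨1, by simp, by simp, by simp⟩

theorem mul {f g : ℕ → ℚ} {D E : ℕ} {c d : ℚ} (hf : IsPolynomialWith f D c)
    (hg : IsPolynomialWith g E d) : IsPolynomialWith (f * g) (D + E) (c * d * (D + E).choose D) := by
  obtain ⟨P, hP, hPD, rfl⟩ := hf
  obtain ⟨Q, hQ, hQE, rfl⟩ := hg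
  refine ⟨P * Q, fun n => by simp [hP, hQ], Polynomial.natDegree_mul_le_of_le hPD hQE, ?_⟩
  rw [Polynomial.coeff_mul_add_eq_of_natDegree_le hPD hQE, ← Nat.add_choose_mul_factorial_mul_factorial]
  rw [Nat.choose_symm_add]
  push_cast
  ring

/-- The polynomial whose values are the sums of `p`-th powers. -/
theorem exists_sum_range_pow (p : ℕ) : ∃ S : Polynomial ℚ,
    (∀ n : ℕ, ∑ k ∈ range n, (k : ℚ) ^ p = S.eval (n : ℚ)) ∧ S.natDegree ≤ p + 1 ∧
    S.coeff (p + 1) = 1 / (p + 1) := by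
  have hp : (p + 1 : ℚ) ≠ 0 := by positivity
  refine ⟨Polynomial.C (1 / (p + 1 : ℚ)) * (Polynomial.bernoulli (p + 1) -
    Polynomial.C (_root_.bernoulli (p + 1))), fun n => ?_, ?_, ?_⟩
  · have := Polynomial.sum_range_pow_eq_bernoulli_sub n p
    rw [Polynomial.eval_mul, Polynomial.eval_sub, Polynomial.eval_C, Polynomial.eval_C,
      ← Nat.succ_eq_add_one, ← this]
    field_simp
  · refine (Polynomial.natDegree_C_mul_le _ _).trans ?_
    rw [Polynomial.natDegree_le_iff_coeff_eq_zero]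
    intro N hN
    rw [Polynomial.coeff_sub, Polynomial.coeff_bernoulli, if_neg (by omega),
      Polynomial.coeff_C_of_ne_zero (by omega), sub_zero]
  · rw [Polynomial.coeff_C_mul, Polynomial.coeff_sub, Polynomial.coeff_bernoulli,
      Polynomial.coeff_C_of_ne_zero (by omega)]
    simp

/-- Only the top power contributes in degree `D + 1`, with factor `1 / (D + 1)`, which the passage
from `D!` to `(D + 1)!` cancels. -/
theorem sum_range {f : ℕ → ℚ} {D : ℕ} {c : ℚ} (hf : IsPolynomialWith f D c) :
    IsPolynomialWith (fun n => ∑ k ∈ range (n + 1), f k) (D + 1) c := by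
  obtain ⟨P, hP, hPD, rfl⟩ := hf
  choose S hS hSd hSc using exists_sum_range_pow
  -- The power sums `S p` stop at `n - 1`; the summand `P` is the term `k = n`.
  refine ⟨(∑ p ∈ range (D + 1), Polynomial.C (P.coeff p) * S p) + P, fun n => ?_, ?_, ?_⟩
  · simp only [sum_range_succ _ n, Polynomial.eval_add, Polynomial.eval_finsetSum,
      Polynomial.eval_mul, Polynomial.eval_C, ← hS, hP]
    congr 1
    simp only [mul_sum]
    rw [sum_comm]
    exact sum_congr rfl fun k _ => Polynomial.eval_eq_sum_range' (by omega) _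
  · refine Polynomial.natDegree_add_le_of_degree_le
      (Polynomial.natDegree_sum_le_of_forall_le _ _ fun p hp => ?_) (by omega)
    have := mem_range.mp hp
    exact (Polynomial.natDegree_C_mul_le _ _).trans ((hSd p).trans (by omega))
  · have h1 : ∀ p ∈ range D, (Polynomial.C (P.coeff p) * S p).coeff (D + 1) = 0 := by
      intro p hp
      have := mem_range.mp hp
      rw [Polynomial.coeff_C_mul,
        Polynomial.coeff_eq_zero_of_natDegree_lt ((hSd p).trans_lt (by omega)), mul_zero]
    rw [Polynomial.coeff_add, Polynomial.coeff_eq_zero_of_natDegree_lt (show P.natDegree < D + 1 by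
      omega), Polynomial.finsetSum_coeff, sum_range_succ, sum_eq_zero h1, Polynomial.coeff_C_mul,
      hSc, Nat.factorial_succ]
    have hD : (D + 1 : ℚ) ≠ 0 := by positivity
    push_cast
    field_simp
    ring

end IsPolynomialWith

theorem multichoose_succ_eq_sum (r n : ℕ) :
    (r + 1).multichoose n = ∑ k ∈ range (n + 1), r.multichoose k := by
  rw [Nat.sum_range_multichoose, Nat.multichoose_eq, ← Nat.choose_symm_of_eq_add (a := r)]
  · congr 1
    omega
  · omega

theorem isPolynomialWith_multichoose (r : ℕ) :
    IsPolynomialWith (fun n => ((r + 1).multichoose n : ℚ)) r 1 := by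
  induction r with
  | zero =>
    convert IsPolynomialWith.one using 1
    ext n
    simp
  | succ r ih =>
    convert ih.sum_range using 1
    ext n
    rw [multichoose_succ_eq_sum]
    push_cast
    rfl

/-- In terms of generating series this is multiplication by `(1 - t)^(-r)`, that is, `r` partial
summations. Geometrically, enlarging the vertex of a cone preserves its degree. -/
theorem IsPolynomialWith.sum_antidiagonal_multichoose {g : ℕ → ℚ} {D : ℕ} {c : ℚ}
    (hg : IsPolynomialWith g D c) (r : ℕ) :
    IsPolynomialWith (fun n => ∑ x ∈ antidiagonal n, (r.multichoose x.1 : ℚ) * g x.2)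
      (r + D) c := by
  induction r with
  | zero =>
    rw [zero_add]
    convert hg using 1
    ext n
    rw [Finset.Nat.sum_antidiagonal_eq_sum_range_succ_mk, sum_range_succ']
    simp
  | succ r ih =>
    rw [add_right_comm]
    convert ih.sum_range using 1
    ext n
    induction n with
    | zero => simp
    | succ n ihn =>
      rw [sum_range_succ, ← ihn, Finset.Nat.antidiagonal_succ]
      simp only [Function.Embedding.prodMap, Function.Embedding.coeFn_mk, Prod.map,
        Function.Embedding.refl_apply, sum_cons, sum_map, Nat.multichoose_succ_succ, Nat.cast_add, add_mul,
        sum_add_distrib, Nat.multichoose_zero_right]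
      simp
      ring

theorem IsPolynomialWith.hasDegree {σ : Type*} [Fintype σ] {X : Set (ℙ ℂ (σ → ℂ))} {D d : ℕ}
    (h : IsPolynomialWith (fun n => (ProjGeom.hilbertFunction X n : ℚ)) D d) (hd : d ≠ 0) :
    ProjGeom.HasDegree X d := by
  obtain ⟨P, hP, hPD, hc⟩ := h
  have h0 : P.coeff D ≠ 0 := by
    intro h0
    rw [h0, zero_mul] at hc
    exact hd (by exact_mod_cast hc.symm)
  have hD : P.natDegree = D := le_antisymm hPD (Polynomial.le_natDegree_of_ne_zero h0)
  refine ⟨P, Filter.Eventually.of_forall hP, ?_⟩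
  rw [Polynomial.leadingCoeff, hD, hc]

/-! ### Zariski closure and degree of the cone. -/

namespace SegreCone.ConeData

open MvPolynomial

variable {σ μ ι κ : Type*} (D : ConeData σ μ ι κ) [Fintype σ]

theorem zariskiClosure_subset_projCone {S : Set (ℙ ℂ (σ → ℂ))} (hS : S ⊆ D.projCone) :
    ProjGeom.zariskiClosure S ⊆ D.projCone := by
  intro p hp
  refine D.mem_affineCone_iff.mpr ⟨?_, fun j j' k k' => ?_⟩
  · ext t
    have := hp 1 (linForm ((LinearMap.proj t).comp
      (LinearMap.id - (D.base.comp D.baseInv + D.seg.comp D.segInv)))) (isHomogeneous_linForm _)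
      (fun s hs => by
        rw [eval_linForm]
        simpa [sub_eq_zero] using congrFun (D.eq_of_mem (hS hs)) t)
    rw [eval_linForm] at this
    simpa [sub_eq_zero] using this
  · let f : ι → κ → MvPolynomial σ ℂ := fun j k => linForm ((LinearMap.proj (j, k)).comp D.segInv)
    have hf : ∀ j k, (f j k).IsHomogeneous 1 := fun j k => isHomogeneous_linForm _
    have := hp 2 (f j k * f j' k' - f j k' * f j' k)
      (((hf j k).mul (hf j' k')).sub ((hf j k').mul (hf j' k))) (fun s hs => by
        simpa [f] using D.minor_eq_zero_of_mem (hS hs) j j' k k')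
    simpa [f] using this

-- A form vanishing on `S` pulls back to a polynomial vanishing on a product of infinite sets, hence
-- to zero.
omit [Fintype σ] in
theorem projCone_subset_zariskiClosure [Finite μ] [Fintype ι] [Fintype κ]
    {S : Set (ℙ ℂ (σ → ℂ))} (box : μ ⊕ ι ⊕ κ → Set ℂ) (hbox : ∀ x, (box x).Infinite)
    (hS : ∀ y ∈ Set.univ.pi box, ∃ h, Projectivization.mk ℂ (D.point (fun s => y (Sum.inl s))
      (fun j => y (Sum.inr (Sum.inl j))) (fun k => y (Sum.inr (Sum.inr k)))) h ∈ S) :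
    D.projCone ⊆ ProjGeom.zariskiClosure S := by
  intro p hp n F hF hFS
  refine (D.pullback_eq_zero_iff F).mp ?_ _ hp
  refine MvPolynomial.funext_set box hbox fun y hy => ?_
  obtain ⟨h, hyS⟩ := hS y hy
  rw [eval_pullback, map_zero]
  exact (eval_rep_eq_zero_iff hF h).mp (hFS _ hyS)

omit [Fintype σ] in
theorem finrank_range_base [Fintype μ] :
    Module.finrank ℂ (LinearMap.range D.base) = Fintype.card μ := by
  rw [LinearMap.finrank_range_of_inj D.base_injective, Module.finrank_pi]

theorem hasDegree_projCone {r a b : ℕ} [Fintype μ] [Fintype ι] [Fintype κ]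
    (hμ : Fintype.card μ = r + 1) (hι : Fintype.card ι = a + 1) (hκ : Fintype.card κ = b + 1) :
    ProjGeom.HasDegree D.projCone ((a + b).choose a) := by
  have : Nonempty μ := Fintype.card_pos_iff.mp (by omega)
  have h := (((isPolynomialWith_multichoose a).mul
    (isPolynomialWith_multichoose b)).sum_antidiagonal_multichoose (r + 1))
  refine IsPolynomialWith.hasDegree (D := r + 1 + (a + b)) ?_
    (Nat.choose_pos (Nat.le_add_right a b)).ne'
  convert h using 1
  · ext n
    rw [D.hilbertFunction_projCone, hμ, hι, hκ]
    push_cast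
    rfl
  · simp

end SegreCone.ConeData

/-! ### The mixture transition distribution model in cone coordinates. -/

namespace MTD

/-- Indices of the free entries of an `(n + 1) × (n + 1)` matrix with zero first row and zero row
sums. -/
def indexEquiv (n : ℕ) : Fin (n ^ 2) ≃ Fin n × Fin n :=
  (finCongr (pow_two n)).trans finProdFinEquiv.symm

/-- The `(n + 1) × (n + 1)` matrix with zero first row and zero row sums with given remaining
entries. -/
def zeroSumMatrix {R : Type*} [CommRing R] {n : ℕ} (B : Fin (n ^ 2) → R) (r s : Fin (n + 1)) : R :=
  Fin.cases 0 (fun p => Fin.cases (-∑ q, B ((indexEquiv n).symm (p, q)))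
    (fun q => B ((indexEquiv n).symm (p, q))) s) r

section zeroSumMatrix

variable {R : Type*} [CommRing R] {n : ℕ} (B B' : Fin (n ^ 2) → R)

@[simp] theorem zeroSumMatrix_zero_left (s : Fin (n + 1)) : zeroSumMatrix B 0 s = 0 := rfl

@[simp] theorem zeroSumMatrix_succ_zero (p : Fin n) :
    zeroSumMatrix B p.succ 0 = -∑ q, B ((indexEquiv n).symm (p, q)) := rfl

@[simp] theorem zeroSumMatrix_succ_succ (p q : Fin n) :
    zeroSumMatrix B p.succ q.succ = B ((indexEquiv n).symm (p, q)) := rfl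

theorem zeroSumMatrix_add (r s : Fin (n + 1)) :
    zeroSumMatrix (B + B') r s = zeroSumMatrix B r s + zeroSumMatrix B' r s := by
  cases r using Fin.cases with
  | zero => simp
  | succ p =>
    cases s using Fin.cases with
    | zero => simp [Finset.sum_add_distrib]; ring
    | succ q => simp

theorem zeroSumMatrix_smul (c : R) (r s : Fin (n + 1)) :
    zeroSumMatrix (c • B) r s = c * zeroSumMatrix B r s := by
  cases r using Fin.cases with
  | zero => simp
  | succ p =>
    cases s using Fin.cases with
    | zero => simp [Finset.mul_sum]
    | succ q => simp

theorem sum_zeroSumMatrix (r : Fin (n + 1)) : ∑ s, zeroSumMatrix B r s = 0 := by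
  cases r using Fin.cases with
  | zero => simp
  | succ p => simp [Fin.sum_univ_succ]

/-- A matrix all of whose rows have the same sum, after subtraction of its first row. -/
theorem eq_zeroSumMatrix {q : Fin (n + 1) → Fin (n + 1) → R} {c : R} (hq : ∀ r, ∑ s, q r s = c)
    (r s : Fin (n + 1)) : zeroSumMatrix (fun k => q ((indexEquiv n) k).1.succ
      ((indexEquiv n) k).2.succ - q 0 ((indexEquiv n) k).2.succ) r s = q r s - q 0 s := by
  cases r using Fin.cases with
  | zero => simp
  | succ p =>
    cases s using Fin.cases with
    | zero =>
      have h1 := hq p.succ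
      have h2 := hq 0
      rw [Fin.sum_univ_succ] at h1 h2
      simp only [zeroSumMatrix_succ_zero, Equiv.apply_symm_apply, Finset.sum_sub_distrib]
      linear_combination h2 - h1
    | succ q => simp

theorem ofReal_zeroSumMatrix (B : Fin (n ^ 2) → ℝ) (r s : Fin (n + 1)) :
    ((zeroSumMatrix B r s : ℝ) : ℂ) = zeroSumMatrix (fun k => (B k : ℂ)) r s := by
  cases r using Fin.cases with
  | zero => simp
  | succ p =>
    cases s using Fin.cases with
    | zero => simp
    | succ q => simp

/-- Only the first column can be negative, and its entries are minus sums of `n` numbers of size at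
most `δ`. -/
theorem neg_le_zeroSumMatrix {B : Fin (n ^ 2) → ℝ} {δ : ℝ} (hB : ∀ k, B k ∈ Set.Icc 0 δ)
    (hδ : 0 ≤ δ) (r s : Fin (n + 1)) : -(n * δ) ≤ zeroSumMatrix B r s := by
  have hn : 0 ≤ n * δ := by positivity
  cases r using Fin.cases with
  | zero => simpa using hn
  | succ p =>
    cases s using Fin.cases with
    | zero =>
      rw [zeroSumMatrix_succ_zero, neg_le_neg_iff]
      refine (Finset.sum_le_card_nsmul _ _ δ fun q _ => (hB _).2).trans ?_
      simp
    | succ q =>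
      rw [zeroSumMatrix_succ_succ]
      linarith [(hB ((indexEquiv n).symm (p, q))).1]

end zeroSumMatrix

/-- The sequence of states `0, …, 0, s`. -/
def baseSeq (l : ℕ) {n : ℕ} (s : Fin (n + 1)) : Fin (l + 1) → Fin (n + 1) :=
  Function.update 0 (Fin.last l) s

/-- The sequence of states `0, …, 0, p, 0, …, 0, s` with `p` in position `j`. -/
def spikeSeq {l n : ℕ} (j : Fin l) (p s : Fin (n + 1)) : Fin (l + 1) → Fin (n + 1) :=
  Function.update (baseSeq l s) j.castSucc p

section

variable {l n : ℕ}

@[simp] theorem baseSeq_last (s : Fin (n + 1)) : baseSeq l s (Fin.last l) = s := by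
  simp [baseSeq]

@[simp] theorem baseSeq_castSucc (s : Fin (n + 1)) (j : Fin l) : baseSeq l s j.castSucc = 0 := by
  simp [baseSeq, (Fin.castSucc_lt_last j).ne]

@[simp] theorem spikeSeq_last (j : Fin l) (p s : Fin (n + 1)) :
    spikeSeq j p s (Fin.last l) = s := by
  simp [spikeSeq, (Fin.castSucc_lt_last j).ne']

@[simp] theorem spikeSeq_castSucc (j j' : Fin l) (p s : Fin (n + 1)) :
    spikeSeq j p s j'.castSucc = if j' = j then p else 0 := by
  by_cases h : j' = j
  · simp [spikeSeq, h]
  · simp [spikeSeq, h, Function.update_of_ne]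

end

/-- The map embedding the Segre variety in the ambient space of the model. -/
def segMap (l n : ℕ) : (Fin l × Fin (n ^ 2) → ℂ) →ₗ[ℂ] ((Fin (l + 1) → Fin (n + 1)) → ℂ) where
  toFun M i := ∑ j : Fin l, zeroSumMatrix (fun k => M (j, k)) (i j.castSucc) (i (Fin.last l))
  map_add' M M' := by
    ext i
    rw [Pi.add_apply, ← Finset.sum_add_distrib]
    exact Finset.sum_congr rfl fun j _ => zeroSumMatrix_add _ _ _ _
  map_smul' c M := by
    ext i
    rw [RingHom.id_apply, Pi.smul_apply, smul_eq_mul, Finset.mul_sum]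
    exact Finset.sum_congr rfl fun j _ => zeroSumMatrix_smul _ _ _ _

theorem segMap_apply {l n : ℕ} (M : Fin l × Fin (n ^ 2) → ℂ) (i : Fin (l + 1) → Fin (n + 1)) :
    segMap l n M i =
      ∑ j : Fin l, zeroSumMatrix (fun k => M (j, k)) (i j.castSucc) (i (Fin.last l)) := rfl

theorem segMap_baseSeq {l n : ℕ} (M : Fin l × Fin (n ^ 2) → ℂ) (s : Fin (n + 1)) :
    segMap l n M (baseSeq l s) = 0 := by
  simp [segMap_apply]

theorem segMap_spikeSeq {l n : ℕ} (M : Fin l × Fin (n ^ 2) → ℂ) (j : Fin l) (p s : Fin (n + 1)) :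
    segMap l n M (spikeSeq j p s) = zeroSumMatrix (fun k => M (j, k)) p s := by
  rw [segMap_apply, Finset.sum_eq_single j]
  · simp
  · intro j' _ h
    simp [h]
  · simp

/-- The linear coordinates exhibiting the closure of the model as a cone over a Segre variety. -/
def coneData (l n : ℕ) :
    SegreCone.ConeData (Fin (l + 1) → Fin (n + 1)) (Fin (n + 1)) (Fin l) (Fin (n ^ 2)) where
  last i := i (Fin.last l)
  seg := segMap l n
  baseInv := LinearMap.funLeft ℂ ℂ (baseSeq l)
  -- Both sequences end in the same state, so the difference removes the base component; on `segMap`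
  -- only the spike in position `j` survives.
  segInv := LinearMap.funLeft ℂ ℂ
      (fun x => spikeSeq x.1 (indexEquiv n x.2).1.succ (indexEquiv n x.2).2.succ) -
    LinearMap.funLeft ℂ ℂ (fun x => baseSeq l (indexEquiv n x.2).2.succ)
  baseInv_base u := by
    ext s
    simp [LinearMap.funLeft_apply]
  baseInv_seg M := by
    ext s
    simp [LinearMap.funLeft_apply, segMap_baseSeq]
  segInv_base u := by
    ext x
    simp [LinearMap.funLeft_apply]
  segInv_seg M := by
    ext ⟨j, k⟩
    simp [LinearMap.funLeft_apply, segMap_baseSeq, segMap_spikeSeq]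

theorem coneData_point_apply {l n : ℕ} (u : Fin (n + 1) → ℂ) (a : Fin l → ℂ) (b : Fin (n ^ 2) → ℂ)
    (i : Fin (l + 1) → Fin (n + 1)) : (coneData l n).point u a b i = u (i (Fin.last l)) +
      ∑ j, a j * zeroSumMatrix b (i j.castSucc) (i (Fin.last l)) := by
  change u (i (Fin.last l)) + segMap l n _ i = _
  rw [segMap_apply]
  congr 1
  exact Finset.sum_congr rfl fun j _ => zeroSumMatrix_smul b (a j) _ _

theorem projModel_subset_projCone (l n : ℕ) : projModel l (n + 1) ⊆ (coneData l n).projCone := by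
  rintro _ ⟨_, ⟨q, lam, hq, hlam, rfl⟩, h, rfl⟩
  rw [SegreCone.ConeData.mk_mem_projCone]
  let c : ℂ := 1 / ((n + 1 : ℕ) : ℂ) ^ l
  have hq' : ∀ r, ∑ s, c * (q r s : ℂ) = c := by
    intro r
    rw [← Finset.mul_sum, ← Complex.ofReal_sum, (hq r).2]
    simp
  -- The base is the first row of `q`, and the second Segre factor consists of the differences from
  -- it; `∑ λ j = 1` lets the first row leave the sum over `j`.
  refine ⟨fun s => c * q 0 s, fun j => lam j, fun k => c * q ((indexEquiv n) k).1.succ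
      ((indexEquiv n) k).2.succ - c * q 0 ((indexEquiv n) k).2.succ, ?_⟩
  ext i
  rw [coneData_point_apply]
  simp only [eq_zeroSumMatrix hq', param]
  have hl : ∑ j, (lam j : ℂ) = 1 := by rw [← Complex.ofReal_sum, hlam.2, Complex.ofReal_one]
  simp only [mul_sub, Finset.sum_sub_distrib, ← Finset.sum_mul, hl]
  push_cast
  rw [Finset.mul_sum]
  simp only [c]
  push_cast
  ring_nf

/-- The bound on `b` keeps transition probabilities nonnegative: since `∑ a ≤ 2 * l`, the
perturbation of `u s ≥ 1` is at least `-1`. -/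
theorem exists_mk_mem_projModel {l n : ℕ} (hl : 1 ≤ l) {u : Fin (n + 1) → ℝ} {a : Fin l → ℝ}
    {b : Fin (n ^ 2) → ℝ} (hu : ∀ s, u s ∈ Set.Icc (1 : ℝ) 2) (ha : ∀ j, a j ∈ Set.Icc (1 : ℝ) 2)
    (hb : ∀ k, b k ∈ Set.Icc (0 : ℝ) (1 / (2 * l * (n + 1)))) :
    ∃ h, Projectivization.mk ℂ ((coneData l n).point (fun s => (u s : ℂ)) (fun j => (a j : ℂ))
      (fun k => (b k : ℂ))) h ∈ projModel l (n + 1) := by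
  set v := (coneData l n).point (fun s => (u s : ℂ)) (fun j => (a j : ℂ))
      (fun k => (b k : ℂ)) with hv
  have hv0 : v ≠ 0 := by
    intro h0
    have h1 := congrArg (coneData l n).baseInv hv
    rw [h0, SegreCone.ConeData.baseInv_point, map_zero] at h1
    have h2 : u 0 = 0 := Complex.ofReal_eq_zero.mp (congrFun h1 0).symm
    linarith [(hu 0).1]
  have hlR : (1 : ℝ) ≤ l := by exact_mod_cast hl
  have hLpos : 0 < ∑ j, a j := by
    have : Nonempty (Fin l) := ⟨⟨0, hl⟩⟩
    exact Finset.sum_pos (fun j _ => by linarith [(ha j).1]) Finset.univ_nonempty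
  have hL2 : ∑ j, a j ≤ 2 * l := by
    refine (Finset.sum_le_card_nsmul _ _ 2 fun j _ => (ha j).2).trans ?_
    simp [mul_comm]
  have hUpos : 0 < ∑ s, u s :=
    Finset.sum_pos (fun s _ => by linarith [(hu s).1]) Finset.univ_nonempty
  set L := ∑ j, a j
  set S := ∑ s, u s
  -- Dividing by `S` normalises the rows. The factor `L` compensates for the normalisation `a j / L`
  -- of the mixing weights.
  let q : Fin (n + 1) → Fin (n + 1) → ℝ := fun r s => (u s + L * zeroSumMatrix b r s) / S
  let lam : Fin l → ℝ := fun j => a j / L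
  have hq : ∀ r, q r ∈ stdSimplex ℝ (Fin (n + 1)) := by
    intro r
    constructor
    · intro s
      refine div_nonneg ?_ hUpos.le
      have h1 := neg_le_zeroSumMatrix hb (by positivity) r s
      have h2 : (n : ℝ) * (1 / (2 * l * (n + 1))) ≤ 1 / (2 * l) := by
        rw [mul_one_div, div_le_div_iff₀ (by positivity) (by positivity)]
        nlinarith
      have h3 : -(1 / (2 * l)) ≤ zeroSumMatrix b r s := by linarith
      have h4 : L * -(1 / (2 * l)) ≤ L * zeroSumMatrix b r s :=
        mul_le_mul_of_nonneg_left h3 hLpos.le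
      have h5 : L * (1 / (2 * l)) ≤ 1 := by
        rw [mul_one_div, div_le_one (by positivity)]
        exact hL2
      linarith [(hu s).1]
    · simp only [q]
      rw [← Finset.sum_div, Finset.sum_add_distrib, ← Finset.mul_sum, sum_zeroSumMatrix, mul_zero,
        add_zero]
      exact div_self hUpos.ne'
  have hlam : lam ∈ stdSimplex ℝ (Fin l) := by
    refine ⟨fun j => div_nonneg (by linarith [(ha j).1]) hLpos.le, ?_⟩
    simp only [lam]
    rw [← Finset.sum_div]
    exact div_self hLpos.ne'
  let c : ℝ := 1 / ((n + 1 : ℕ) : ℝ) ^ l / S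
  have hc : c ≠ 0 := by positivity
  have hx : (fun i => ((param l (n + 1) q lam i : ℝ) : ℂ)) = (c : ℂ) • v := by
    ext i
    have hreal : param l (n + 1) q lam i = c * (u (i (Fin.last l)) +
        ∑ j, a j * zeroSumMatrix b (i j.castSucc) (i (Fin.last l))) := by
      have h1 : ∑ j, lam j * q (i j.castSucc) (i (Fin.last l)) = (u (i (Fin.last l)) +
          ∑ j, a j * zeroSumMatrix b (i j.castSucc) (i (Fin.last l))) / S := by
        have h2 : ∀ j, lam j * q (i j.castSucc) (i (Fin.last l)) =
            (a j * (u (i (Fin.last l)) / L) +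
              a j * zeroSumMatrix b (i j.castSucc) (i (Fin.last l))) / S := by
          intro j
          simp only [lam, q]
          field_simp
        rw [Finset.sum_congr rfl fun j _ => h2 j, ← Finset.sum_div, Finset.sum_add_distrib,
          ← Finset.sum_mul, mul_div_cancel₀ _ hLpos.ne']
      rw [param, h1]
      simp only [c]
      ring
    rw [hreal, Pi.smul_apply, hv, coneData_point_apply, smul_eq_mul]
    push_cast
    simp only [ofReal_zeroSumMatrix]
  refine ⟨hv0, param l (n + 1) q lam, ⟨q, lam, hq, hlam, rfl⟩, ?_, ?_⟩
  · rw [hx]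
    exact smul_ne_zero (by exact_mod_cast hc) hv0
  · rw [Projectivization.mk_eq_mk_iff']
    refine ⟨(c : ℂ)⁻¹, ?_⟩
    rw [hx, inv_smul_smul₀ (by exact_mod_cast hc)]

theorem projVariety_eq_projCone {l : ℕ} (hl : 1 ≤ l) (n : ℕ) :
    projVariety l (n + 1) = (coneData l n).projCone := by
  refine Set.Subset.antisymm
    ((coneData l n).zariskiClosure_subset_projCone (projModel_subset_projCone l n)) ?_
  have hinf : ∀ x y : ℝ, x < y → (Complex.ofReal '' Set.Icc x y).Infinite := fun x y h =>
    (Set.Icc_infinite h).image Complex.ofReal_injective.injOn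
  have hlR : (1 : ℝ) ≤ l := by exact_mod_cast hl
  refine (coneData l n).projCone_subset_zariskiClosure
    (Sum.elim (fun _ => Complex.ofReal '' Set.Icc 1 2)
      (Sum.elim (fun _ => Complex.ofReal '' Set.Icc 1 2)
        (fun _ => Complex.ofReal '' Set.Icc 0 (1 / (2 * l * (n + 1)))))) ?_ ?_
  · rintro (s | j | k)
    · exact hinf _ _ (by norm_num)
    · exact hinf _ _ (by norm_num)
    · exact hinf _ _ (by positivity)
  · intro y hy
    choose u hu hu' using fun s => hy (Sum.inl s) (Set.mem_univ _)
    choose a ha ha' using fun j => hy (Sum.inr (Sum.inl j)) (Set.mem_univ _)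
    choose b hb hb' using fun k => hy (Sum.inr (Sum.inr k)) (Set.mem_univ _)
    have := exists_mk_mem_projModel hl hu ha hb
    simpa only [hu', ha', hb'] using this

end MTD

end

theorem corollary4p3 (l m : ℕ) (hl : 1 ≤ l) (hm : 1 ≤ m) :
    (∃ (U : Submodule ℂ ((Fin (l + 1) → Fin m) → ℂ))
      (ψ : (Fin l × Fin ((m - 1) ^ 2) → ℂ) →ₗ[ℂ] ((Fin (l + 1) → Fin m) → ℂ))
      (hψ : Function.Injective ψ),
      Module.finrank ℂ U = m ∧
      Disjoint U (LinearMap.range ψ) ∧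
      MTD.projVariety l m = ProjGeom.coneOver U
        (Projectivization.map ψ hψ '' ProjGeom.segreVariety (Fin l) (Fin ((m - 1) ^ 2))) ∧
      (2 ≤ l → 3 ≤ m →
        ProjGeom.singularLocus (MTD.projVariety l m) =
          (U.projectivization : Set (ℙ ℂ ((Fin (l + 1) → Fin m) → ℂ))))) ∧
    (2 ≤ m → ProjGeom.HasDegree (MTD.projVariety l m)
      ((l + (m - 1) ^ 2 - 2).choose (l - 1))) := by
  obtain ⟨n, rfl⟩ : ∃ n, m = n + 1 := ⟨m - 1, by omega⟩
  have hX := MTD.projVariety_eq_projCone hl n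
  let D := MTD.coneData l n
  refine ⟨⟨LinearMap.range D.base, D.seg, D.seg_injective, ?_, D.disjoint_range, ?_, ?_⟩, ?_⟩
  · rw [D.finrank_range_base, Fintype.card_fin]
  · rw [hX]
    exact D.projCone_eq_coneOver
  · intro h2 h3
    have : Nontrivial (Fin l) := Fin.nontrivial_iff_two_le.mpr h2
    have : Nontrivial (Fin (n ^ 2)) := Fin.nontrivial_iff_two_le.mpr (by nlinarith)
    rw [hX]
    exact D.singularLocus_projCone
  · intro h2
    have hn : 1 ≤ n ^ 2 := Nat.one_le_pow _ _ (by omega)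
    -- The truncated subtractions agree because `l` and `n ^ 2` are both at least `1`.
    have hd : (l + (n + 1 - 1) ^ 2 - 2).choose (l - 1) = (l - 1 + (n ^ 2 - 1)).choose (l - 1) := by
      congr 1
      rw [Nat.add_sub_cancel]
      omega
    rw [hX, hd]
    exact D.hasDegree_projCone (Fintype.card_fin _) (by rw [Fintype.card_fin]; omega)
      (by rw [Fintype.card_fin]; omega)
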